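/- Let $X$ be a $\delta$-hyperbolic space ($\delta>0$), i.e. a geodesic metric space in which every geodesic triangle is $\delta$-thin, and let $x_0\in X$. Let $G$ be a group which is not virtually cyclic and which acts on $X$ by isometries, let $S$ be a finite generating set of $G$ with word metric $d_S(g,h)=\inf\{n\ge 0:\exists s_1,\dots,s_n\in S\cup S^{-1},\ h=gs_1\cdots s_n\}$ and $\|g\|_S=d_S(1,g)$. Let $f\in G$ be * loxodromic: there is $\tau>0$ with $d_X(x_0,f^nx_0)\ge\tau n$ for all $n\in\mathbb N$; * WPD: for every $R>0$ there is an integer $L>0$ such that $\{g\in G: d_X(x_0,gx_0)<R,\ d_X(f^Lx_0,gf^Lx_0)<R\}$ is finite. For $x,y\in X$ put $\mathcal H_{half}(x,y)=\{z\in X: d_X(z,x)\le d_X(z,y)\}$, and let $EC(f)=\{g\in G:\exists n>0,\ gf^ng^{-1}=f^{n}\text{ or } gf^ng^{-1}=f^{-n}\}$. Then the following hold. 1. $S$ contains an element $w\notin EC(f)$. 2. For every $w\in G\setminus EC(f)$ there exists $D_0$ such that for all $\epsilon>0$ and all integers $D>D_0$ there exists $N=N(\epsilon,D)$ such that every finite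 set $A\subseteq G$ has a subset $A'\subseteq A$ with $\#A'\ge(1-\epsilon)\#A$ and with the following property: for each $a\in A'$ there exists $b\in G$ with $d_S(a,b)\le N$ such that $$\{gx_0:g\in A\}\subseteq \mathcal H_{half}(bx_0,bf^Dx_0)$$ and such that $\mathcal H_{half}(bx_0,bf^Dx_0)$ and $bf^Dwf^{-D}b^{-1}\cdot\mathcal H_{half}(bx_0,bf^Dx_0)$ are disjoint. 3. There exists $D_0$ such that for every integer $D>D_0$ the sets $H(g)=\{u\in G: ux_0\in\mathcal H_{half}(gx_0,gf^Dx_0)\}$, $g\in G$, satisfy the following: there is $R>0$ such that every finite $A\subseteq G$ has a subset $A'\subseteq A$ with $\#A'\ge\#A/2$ such that for each $a\in A'$ there are $g,h\in G$ with $\|g\|_S,\|h\|_S\le R$, $A\subseteq aH(g)$ and $H(g)\cap hH(g)=\emptyset$. -/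

import Mathlib

open scoped Pointwise

/-- `s` is (the image of) a geodesic segment from `x` to `y`: the image of an isometric embedding of
the interval `[0, d(x, y)]` which starts at `x` and ends at `y`. -/
def IsGeodesicSegment {X : Type*} [MetricSpace X] (x y : X) (s : Set X) : Prop :=
  ∃ γ : ℝ → X, γ 0 = x ∧ γ (dist x y) = y ∧
    (∀ t ∈ Set.Icc 0 (dist x y), ∀ u ∈ Set.Icc 0 (dist x y), dist (γ t) (γ u) = |t - u|) ∧
    s = γ '' Set.Icc 0 (dist x y)

/-- Every pair of points is connected by a geodesic segment. -/
def IsGeodesicMetricSpace (X : Type*) [MetricSpace X] : Prop :=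
  ∀ x y : X, ∃ s : Set X, IsGeodesicSegment x y s

/-- `X` is a `δ`-hyperbolic space: a geodesic metric space in which every geodesic triangle is
`δ`-thin, where `δ > 0`. -/
def IsDeltaHyperbolic (δ : ℝ) (X : Type*) [MetricSpace X] : Prop :=
  0 < δ ∧ IsGeodesicMetricSpace X ∧
    ∀ (x y z : X) (sxy syz sxz : Set X),
      IsGeodesicSegment x y sxy → IsGeodesicSegment y z syz → IsGeodesicSegment x z sxz →
        ∀ p ∈ sxz, ∃ q ∈ sxy ∪ syz, dist p q ≤ δ

/-- `f` is loxodromic, seen from the basepoint `x₀`. -/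
def IsLoxodromic {G X : Type*} [Group G] [MetricSpace X] [MulAction G X] (x₀ : X) (f : G) : Prop :=
  ∃ τ : ℝ, 0 < τ ∧ ∀ n : ℕ, τ * n ≤ dist x₀ (f ^ n • x₀)

/-- `f` has the weak proper discontinuity property, seen from the basepoint `x₀`. -/
def IsWPD {G X : Type*} [Group G] [MetricSpace X] [MulAction G X] (x₀ : X) (f : G) : Prop :=
  ∀ R : ℝ, 0 < R → ∃ L : ℕ, 0 < L ∧
    {g : G | dist x₀ (g • x₀) < R ∧ dist (f ^ L • x₀) (g • f ^ L • x₀) < R}.Finite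

/-- `G` has a cyclic subgroup of finite index. -/
def IsVirtuallyCyclic (G : Type*) [Group G] : Prop :=
  ∃ H : Subgroup G, IsCyclic H ∧ H.FiniteIndex

/-- The elementary closure of `f`: all `g` with `g f ^ n g⁻¹ = f ^ n` or `g f ^ n g⁻¹ = f ^ (-n)`
for some `n > 0`. -/
def elementaryClosure {G : Type*} [Group G] (f : G) : Set G :=
  {g : G | ∃ n : ℕ, 0 < n ∧ (g * f ^ n * g⁻¹ = f ^ n ∨ g * f ^ n * g⁻¹ = (f ^ n)⁻¹)}

/-- The word metric `d_S(g, h)`: the least `n` such that `h = g s₁ ⋯ sₙ` with all `sᵢ ∈ S ∪ S⁻¹`.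
It is only used for generating sets `S`, for which such an `n` exists. -/
noncomputable def wordDist {G : Type*} [Group G] (S : Set G) (g h : G) : ℕ :=
  sInf {n : ℕ | ∃ l : List G, l.length = n ∧ (∀ s ∈ l, s ∈ S ∪ S⁻¹) ∧ h = g * l.prod}

/-- The word norm `‖g‖_S = d_S(1, g)`. -/
noncomputable def wordNorm {G : Type*} [Group G] (S : Set G) (g : G) : ℕ :=
  wordDist S 1 g

/-- The halfspace `H_half(x, y)` of all points that are at least as close to `x` as to `y`. -/
def halfspace {X : Type*} [MetricSpace X] (x y : X) : Set X :=
  {z : X | dist z x ≤ dist z y}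

/-- Hutchcroft's supporting halfspace condition on a family `H` of subsets of `G`: there is `R > 0`
such that every finite `A ⊆ G` has a subset `A'` with `#A' ≥ #A / 2`, each of whose elements `a`
admits `g, h` of word norm at most `R` with `A ⊆ a H(g)` and `H(g) ∩ h H(g) = ∅`. -/
def SupportingHalfspaceCondition {G : Type*} [Group G] (S : Set G) (H : G → Set G) : Prop :=
  ∃ R : ℝ, 0 < R ∧ ∀ A : Finset G, ∃ A' : Finset G, A' ⊆ A ∧ (A.card : ℝ) / 2 ≤ A'.card ∧
    ∀ a ∈ A', ∃ g h : G, (wordNorm S g : ℝ) ≤ R ∧ (wordNorm S h : ℝ) ≤ R ∧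
      (A : Set G) ⊆ a • H g ∧ H g ∩ h • H g = ∅

/-!
Everything takes place in the orbit of `x₀` and uses only Gromov's four-point condition, which
follows from thin triangles (`IsDeltaHyperbolic.fourPoint`). For a loxodromic `f` the displacements
`d(x₀, f ^ n x₀)` are additive up to a constant (`IsLoxodromic.exists_orbitDefect`), so the orbit of
`f` behaves like a geodesic line.

If `w` moves all the points `f ^ s x₀`, `s ≥ 0`, by a bounded amount, then WPD makes two of the
elements `f ^ (-s) w f ^ s` equal, so that `w` commutes with a power of `f`. Hence for `w` outside
the elementary closure the rays `f ^ s x₀` and `w f ^ s x₀` diverge, and halfspaces far out along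
them are disjoint (`exists_disjoint_halfspaces`). If the elementary closure had finite index, it
would be finitely generated, all its elements would normalise a common power of `f`, and WPD would
make the group generated by `f` a subgroup of finite index (`isVirtuallyCyclic_of_finiteIndex`). So
there are three elements `c i` in different left cosets of the elementary closure. This includes the
first claim, as otherwise the elementary closure would be `G`.

For the supporting halfspaces, call `u` a branch point of the finite set `A` if `A` has points in
the shadows of all three rays `u c i f ^ s x₀`. Two facts are combined.

* The number of branch points is at most `N * #A` (`exists_card_le_mul_card`), as in a tree, where
  it is less than the number of leaves. The points of `A` are added one at a time; the next one is
  always chosen so that its largest Gromov product with the earlier ones is as small as possible.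
  Then the branch points that a new `g` creates lie on a geodesic from `x₀` to `g x₀` in a segment of
  bounded length, and by WPD there are boundedly many of them. The order matters because shadows have
  no sharp boundary: a point can be the first one in a shadow at `u` although its geodesic branches
  off from those of earlier points far from `u`.
* The group expands: there is a finite `P` with `2 * #F ≤ #(F * P)` for all finite `F`, by ping-pong
  with the conjugates of a power of `f` by the `c i` (`exists_two_mul_card_le_card_mul`).

If `U` is the set of those `a ∈ A` for which no halfspace at `a x`, with `x` in the finite set
`P ^ k * {c i}`, contains `A`, then all elements of `U * P ^ k` are branch points of `A`. Thus
`2 ^ k * #U ≤ N * #A`, and `U` is as small a part of `A` as desired for large `k`.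
-/

open scoped Pointwise

/-! ### The four-point condition -/

/-- Gromov's four-point condition with additive constant `Δ`. -/
def FourPoint (Δ : ℝ) (X : Type*) [MetricSpace X] : Prop :=
  ∀ x y z w : X,
    dist x z + dist y w ≤ max (dist x y + dist z w) (dist x w + dist y z) + Δ

section FourPoint

variable {X : Type*} [MetricSpace X]

theorem FourPoint.or {Δ : ℝ} (hX : FourPoint Δ X) (x y z w : X) :
    dist x z + dist y w ≤ dist x y + dist z w + Δ ∨
      dist x z + dist y w ≤ dist x w + dist y z + Δ := by
  have h := hX x y z w
  rcases le_total (dist x y + dist z w) (dist x w + dist y z) with h' | h'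
  · rw [max_eq_right h'] at h
    exact Or.inr h
  · rw [max_eq_left h'] at h
    exact Or.inl h

namespace IsGeodesicSegment

variable {x y p : X} {s : Set X}

theorem dist_add_dist (h : IsGeodesicSegment x y s) (hp : p ∈ s) :
    dist x p + dist p y = dist x y := by
  obtain ⟨γ, h0, h1, hiso, rfl⟩ := h
  obtain ⟨t, ht, rfl⟩ := hp
  have hd : (0 : ℝ) ≤ dist x y := dist_nonneg
  have e1 := hiso 0 ⟨le_rfl, hd⟩ t ht
  have e2 := hiso t ht _ ⟨hd, le_rfl⟩
  rw [h0, abs_sub_comm, sub_zero, abs_of_nonneg ht.1] at e1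
  rw [h1, abs_sub_comm, abs_of_nonneg (sub_nonneg.2 ht.2)] at e2
  linarith

theorem left_mem (h : IsGeodesicSegment x y s) : x ∈ s := by
  obtain ⟨γ, h0, -, -, rfl⟩ := h
  exact ⟨0, ⟨le_rfl, dist_nonneg⟩, h0⟩

theorem right_mem (h : IsGeodesicSegment x y s) : y ∈ s := by
  obtain ⟨γ, -, h1, -, rfl⟩ := h
  exact ⟨_, ⟨dist_nonneg, le_rfl⟩, h1⟩

theorem isCompact_isPreconnected (h : IsGeodesicSegment x y s) :
    IsCompact s ∧ IsPreconnected s := by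
  obtain ⟨γ, -, -, hiso, rfl⟩ := h
  have hc : ContinuousOn γ (Set.Icc 0 (dist x y)) := by
    refine LipschitzOnWith.continuousOn (K := 1) (LipschitzOnWith.of_dist_le_mul ?_)
    intro t ht u hu
    rw [hiso t ht u hu, NNReal.coe_one, one_mul, Real.dist_eq]
  exact ⟨isCompact_Icc.image_of_continuousOn hc, isPreconnected_Icc.image γ hc⟩

end IsGeodesicSegment

/-- A side of a geodesic triangle contains a point close to both other sides, because it is
connected. -/
theorem IsDeltaHyperbolic.exists_center {δ : ℝ} (hX : IsDeltaHyperbolic δ X) {x w z : X}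
    {sxw swz sxz : Set X} (hxw : IsGeodesicSegment x w sxw) (hwz : IsGeodesicSegment w z swz)
    (hxz : IsGeodesicSegment x z sxz) :
    ∃ p ∈ sxz, (∃ q ∈ sxw, dist p q ≤ δ) ∧ ∃ r ∈ swz, dist p r ≤ δ := by
  obtain ⟨hδ, -, hthin⟩ := hX
  have hmem : ∀ {x y : X} {s : Set X}, IsGeodesicSegment x y s → ∀ p,
      p ∈ Metric.cthickening δ s ↔ ∃ q ∈ s, dist p q ≤ δ := by
    intro x y s hs p
    rw [hs.isCompact_isPreconnected.1.cthickening_eq_biUnion_closedBall hδ.le]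
    simp
  obtain ⟨p, hp, hp1, hp2⟩ := isPreconnected_closed_iff.1 hxz.isCompact_isPreconnected.2
    (Metric.cthickening δ sxw) (Metric.cthickening δ swz) Metric.isClosed_cthickening
    Metric.isClosed_cthickening
    (by
      intro p hp
      obtain ⟨q, hq | hq, hpq⟩ := hthin x w z sxw swz sxz hxw hwz hxz p hp
      · exact Or.inl ((hmem hxw p).2 ⟨q, hq, hpq⟩)
      · exact Or.inr ((hmem hwz p).2 ⟨q, hq, hpq⟩))
    ⟨x, hxz.left_mem, (hmem hxw x).2 ⟨x, hxw.left_mem, by simpa using hδ.le⟩⟩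
    ⟨z, hxz.right_mem, (hmem hwz z).2 ⟨z, hwz.right_mem, by simpa using hδ.le⟩⟩
  exact ⟨p, hp, (hmem hxw p).1 hp1, (hmem hwz p).1 hp2⟩

/-- The distance from `w` to a geodesic `[x, z]` is the Gromov product of `x` and `z` at `w` up to
`2δ`; together with thinness of the triangle `x, y, z` this gives the four-point condition. -/
theorem IsDeltaHyperbolic.fourPoint {δ : ℝ} (hX : IsDeltaHyperbolic δ X) :
    FourPoint (6 * δ) X := by
  intro x y z w
  obtain ⟨sxw, hxw⟩ := hX.2.1 x w
  obtain ⟨swz, hwz⟩ := hX.2.1 w z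
  obtain ⟨sxz, hxz⟩ := hX.2.1 x z
  obtain ⟨sxy, hxy⟩ := hX.2.1 x y
  obtain ⟨syz, hyz⟩ := hX.2.1 y z
  obtain ⟨p, hp, ⟨q, hq, hpq⟩, r, hr, hpr⟩ := hX.exists_center hxw hwz hxz
  have e1 := hxw.dist_add_dist hq
  have e2 := hwz.dist_add_dist hr
  have e3 := hxz.dist_add_dist hp
  have t1 := dist_triangle x q p
  have t2 := dist_triangle p q w
  have t3 := dist_triangle p r z
  have t4 := dist_triangle w r p
  have c1 := dist_comm q p
  have c2 := dist_comm r p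
  have c3 := dist_comm w p
  have c4 := dist_comm w z
  obtain ⟨v, hv, hpv⟩ := hX.2.2 x y z sxy syz sxz hxy hyz hxz p hp
  have t5' := dist_triangle w p v
  have c5 := dist_comm v p
  rcases hv with hv | hv
  · have e4 := hxy.dist_add_dist hv
    have t6 := dist_triangle x v w
    have t7 := dist_triangle y v w
    have c6 := dist_comm v y
    have c7 := dist_comm v w
    have := le_max_left (dist x y + dist z w) (dist x w + dist y z)
    linarith
  · have e4 := hyz.dist_add_dist hv
    have t6 := dist_triangle z v w
    have t7 := dist_triangle y v w
    have c6 := dist_comm v z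
    have c7 := dist_comm v w
    have := le_max_right (dist x y + dist z w) (dist x w + dist y z)
    linarith

end FourPoint

/-! ### Orbits of loxodromic isometries -/

section Orbit

variable {G X : Type*} [Group G] [MetricSpace X] [MulAction G X]

/-- The displacement of the basepoint `x₀` under `f ^ n`. -/
noncomputable def powDisp (f : G) (x₀ : X) (n : ℕ) : ℝ := dist x₀ (f ^ n • x₀)

theorem powDisp_nonneg (f : G) (x₀ : X) (n : ℕ) : 0 ≤ powDisp f x₀ n := dist_nonneg

/-- The orbit `n ↦ f ^ n x₀` satisfies the reverse triangle inequality up to `K`. -/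
def OrbitDefect (f : G) (x₀ : X) (K : ℝ) : Prop :=
  ∀ i j : ℕ, powDisp f x₀ i + powDisp f x₀ j ≤ powDisp f x₀ (i + j) + K

theorem OrbitDefect.nonneg {f : G} {x₀ : X} {K : ℝ} (h : OrbitDefect f x₀ K) : 0 ≤ K := by
  simpa [powDisp] using h 0 0

theorem IsLoxodromic.tendsto_powDisp {f : G} {x₀ : X} (h : IsLoxodromic x₀ f) :
    Filter.Tendsto (powDisp f x₀) Filter.atTop Filter.atTop := by
  obtain ⟨τ, hτ, h⟩ := h
  exact Filter.tendsto_atTop_mono h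
    (tendsto_natCast_atTop_atTop.const_mul_atTop hτ)

theorem IsLoxodromic.exists_forall_ge_powDisp {f : G} {x₀ : X} (h : IsLoxodromic x₀ f) (R : ℝ) :
    ∃ N : ℕ, ∀ n : ℕ, N ≤ n → R ≤ powDisp f x₀ n :=
  Filter.eventually_atTop.1 (h.tendsto_powDisp.eventually_ge_atTop R)

/-- Linear growth of displacements forbids that doubling the exponent always increases the
displacement by a bounded amount only. -/
theorem IsLoxodromic.exists_add_le_powDisp_two_mul {f : G} {x₀ : X} (h : IsLoxodromic x₀ f)
    (C : ℝ) (hC : 0 ≤ C) :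
    ∃ m : ℕ, 0 < m ∧ powDisp f x₀ m + C ≤ powDisp f x₀ (m + m) := by
  obtain ⟨τ, hτ, h⟩ := h
  by_contra! hcon
  have hpow : ∀ k : ℕ, powDisp f x₀ (2 ^ k) ≤ powDisp f x₀ 1 + C * k := by
    intro k
    induction k with
    | zero => simp
    | succ k ih =>
      have := hcon (2 ^ k) (by positivity)
      rw [pow_succ, mul_two]
      push_cast
      linarith
  obtain ⟨j, hj⟩ := exists_nat_gt ((powDisp f x₀ 1 + 2 * C) / τ)
  rw [div_lt_iff₀ hτ] at hj
  have h1 := hpow (2 * j)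
  have h2 : τ * (2 ^ (2 * j) : ℕ) ≤ powDisp f x₀ (2 ^ (2 * j)) := h _
  have h3 : ((1 : ℝ) + j) ≤ 2 ^ j := by
    have := one_add_mul_le_pow (a := (1 : ℝ)) (by norm_num) j
    norm_num at this
    exact this
  have h4 : ((1 : ℝ) + j) * (1 + j) ≤ (2 ^ (2 * j) : ℕ) := by
    push_cast
    rw [two_mul, pow_add]
    gcongr
  have h5 : τ * (((1 : ℝ) + j) * (1 + j)) ≤ τ * (2 ^ (2 * j) : ℕ) := by gcongr
  have h6 : 0 ≤ powDisp f x₀ 1 := powDisp_nonneg _ _ _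
  push_cast at h1
  have hj0 : (0 : ℝ) ≤ j := Nat.cast_nonneg j
  nlinarith

variable [IsIsometricSMul G X]

theorem dist_mul_pow_smul (b f : G) (x₀ : X) (i j : ℕ) :
    dist ((b * f ^ i) • x₀) ((b * f ^ (i + j)) • x₀) = powDisp f x₀ j := by
  rw [pow_add, ← mul_assoc, mul_smul (b * f ^ i), dist_smul, powDisp]

theorem dist_smul_mul_pow_smul (b f : G) (x₀ : X) (j : ℕ) :
    dist (b • x₀) ((b * f ^ j) • x₀) = powDisp f x₀ j := by
  rw [mul_smul, dist_smul, powDisp]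

theorem powDisp_add_le (f : G) (x₀ : X) (i j : ℕ) :
    powDisp f x₀ (i + j) ≤ powDisp f x₀ i + powDisp f x₀ j := by
  have h := dist_triangle x₀ (f ^ i • x₀) (f ^ (i + j) • x₀)
  have e := dist_mul_pow_smul 1 f x₀ i j
  rw [one_mul, one_mul] at e
  rwa [e] at h

theorem powDisp_le_mul (f : G) (x₀ : X) (n : ℕ) :
    powDisp f x₀ n ≤ n * powDisp f x₀ 1 := by
  induction n with
  | zero => simp [powDisp]
  | succ n ih =>
    have := powDisp_add_le f x₀ n 1
    push_cast
    linarith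

theorem powDisp_inv (f : G) (x₀ : X) (n : ℕ) : powDisp f⁻¹ x₀ n = powDisp f x₀ n := by
  rw [powDisp, powDisp, ← dist_smul (f ^ n), smul_smul, inv_pow, mul_inv_cancel, one_smul, dist_comm]

theorem OrbitDefect.inv {f : G} {x₀ : X} {K : ℝ} (h : OrbitDefect f x₀ K) :
    OrbitDefect f⁻¹ x₀ K := by
  intro i j
  simpa only [powDisp_inv] using h i j

/-- Orbits of loxodromic isometries of hyperbolic spaces are quasi-geodesics whose triangle
inequalities are equalities up to a constant. -/
theorem IsLoxodromic.exists_orbitDefect {Δ : ℝ} (hX : FourPoint Δ X) (hΔ : 0 < Δ) {f : G} {x₀ : X}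
    (h : IsLoxodromic x₀ f) : ∃ K : ℝ, OrbitDefect f x₀ K := by
  obtain ⟨m, hm, hgap⟩ := h.exists_add_le_powDisp_two_mul (2 * Δ) (by positivity)
  set a := powDisp f x₀ with ha
  have hd : ∀ i j : ℕ, dist (f ^ i • x₀) (f ^ (i + j) • x₀) = a j := fun i j => by
    simpa using dist_mul_pow_smul 1 f x₀ i j
  have hd0 : ∀ j : ℕ, dist x₀ (f ^ j • x₀) = a j := fun j => rfl
  -- Along the powers of `f ^ m` the displacement grows by at least `Δ` in each step.
  have hstep : ∀ n : ℕ, a (m * n) + Δ ≤ a (m * n + m) := by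
    intro n
    induction n with
    | zero =>
      have h0 : a 0 = 0 := by simp [ha, powDisp]
      have h2 := powDisp_add_le f x₀ m m
      simp only [mul_zero, zero_add, h0]
      linarith
    | succ n ih =>
      have e1 := hd (m * n) m
      have e2 := hd (m * n) (m + m)
      have e3 := hd (m * n + m) m
      rw [← add_assoc] at e2
      have := hX.or x₀ (f ^ (m * n) • x₀) (f ^ (m * n + m) • x₀) (f ^ (m * n + m + m) • x₀)
      rw [hd0, hd0, hd0, e1, e2, e3] at this
      rw [mul_add, mul_one]
      rcases this with h | h <;> linarith
  have hdefect : ∀ p q : ℕ, a (m * p) + a (m * q) ≤ a (m * (p + q)) + (a m + Δ) := by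
    intro p q
    rcases q with _ | q
    · have h0 : a 0 = 0 := by simp [ha, powDisp]
      have : 0 ≤ a m := powDisp_nonneg _ _ _
      simp only [mul_zero, add_zero, h0]
      linarith
    · have e1 := hd (m * p) m
      have e2 := hd (m * p) (m * q + m)
      have e3 := hd (m * p + m) (m * q)
      have e4 : m * p + (m * q + m) = m * (p + (q + 1)) := by ring
      have e5 : m * p + m + m * q = m * (p + (q + 1)) := by ring
      rw [e4] at e2
      rw [e5] at e3
      have := hX.or x₀ (f ^ (m * p) • x₀) (f ^ (m * p + m) • x₀) (f ^ (m * (p + (q + 1))) • x₀)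
      rw [hd0, hd0, hd0, e1, e2, e3] at this
      have s1 := hstep p
      have s2 := hstep q
      rw [mul_add m q 1, mul_one]
      rcases this with h | h <;> linarith
  have hmod : ∀ r : ℕ, r < m → a r ≤ m * a 1 := by
    intro r hr
    refine (powDisp_le_mul f x₀ r).trans ?_
    gcongr
    exact powDisp_nonneg _ _ _
  have hr : ∀ i r : ℕ, a i ≤ a (i + r) + a r := by
    intro i r
    have h1 := dist_triangle_right x₀ (f ^ i • x₀) (f ^ (i + r) • x₀)
    rw [hd] at h1
    exact h1
  refine ⟨a m + Δ + 4 * (m * a 1), fun i j => ?_⟩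
  have hi := Nat.div_add_mod i m
  have hj := Nat.div_add_mod j m
  have l1 := powDisp_add_le f x₀ (m * (i / m)) (i % m)
  have l2 := powDisp_add_le f x₀ (m * (j / m)) (j % m)
  have l3 := hr (m * (i / m + j / m)) (i % m)
  have l4 := hr (m * (i / m + j / m) + i % m) (j % m)
  have e : m * (i / m + j / m) + i % m + j % m = i + j := by
    rw [mul_add]
    omega
  rw [hi] at l1
  rw [hj] at l2
  rw [e] at l4
  have b1 := hmod (i % m) (Nat.mod_lt _ hm)
  have b2 := hmod (j % m) (Nat.mod_lt _ hm)
  have := hdefect (i / m) (j / m)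
  linarith

end Orbit

/-! ### The elementary closure -/

section ElementaryClosure

variable {G X : Type*} [Group G] [MetricSpace X] [MulAction G X]

/-- The subgroup of all `g` that conjugate `f ^ n` to itself or to its inverse. -/
def powNormalizer (f : G) (n : ℕ) : Subgroup G where
  carrier := {g | g * f ^ n * g⁻¹ = f ^ n ∨ g * f ^ n * g⁻¹ = (f ^ n)⁻¹}
  one_mem' := Or.inl (by simp)
  mul_mem' := by
    intro a b ha hb
    have e : a * b * f ^ n * (a * b)⁻¹ = a * (b * f ^ n * b⁻¹) * a⁻¹ := by group
    have e' : a * (f ^ n)⁻¹ * a⁻¹ = (a * f ^ n * a⁻¹)⁻¹ := by group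
    rcases ha with ha | ha <;> rcases hb with hb | hb <;>
      simp only [Set.mem_ofPred_eq, e, hb, ha, e', inv_inv, true_or, or_true]
  inv_mem' := by
    intro a ha
    have e : a⁻¹ * (a * f ^ n * a⁻¹) * a⁻¹⁻¹ = f ^ n := by group
    have e' : a⁻¹ * (f ^ n)⁻¹ * a⁻¹⁻¹ = (a⁻¹ * f ^ n * a⁻¹⁻¹)⁻¹ := by group
    rcases ha with ha | ha
    · left
      rwa [ha] at e
    · right
      rw [ha, e'] at e
      exact inv_eq_iff_eq_inv.1 e

theorem powNormalizer_le_of_dvd (f : G) {m n : ℕ} (h : m ∣ n) :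
    powNormalizer f m ≤ powNormalizer f n := by
  obtain ⟨k, rfl⟩ := h
  intro g hg
  rcases hg with hg | hg
  · left
    rw [pow_mul, ← conj_pow, hg]
  · right
    rw [pow_mul, ← conj_pow, hg, inv_pow]

/-- The elementary closure is the union of the directed family `powNormalizer f n`, `n > 0`. -/
def elementarySubgroup (f : G) : Subgroup G where
  carrier := elementaryClosure f
  one_mem' := ⟨1, one_pos, (powNormalizer f 1).one_mem⟩
  mul_mem' := by
    rintro a b ⟨m, hm, ha⟩ ⟨n, hn, hb⟩
    exact ⟨m * n, Nat.mul_pos hm hn, (powNormalizer f (m * n)).mul_mem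
      (powNormalizer_le_of_dvd f (dvd_mul_right m n) ha)
      (powNormalizer_le_of_dvd f (dvd_mul_left n m) hb)⟩
  inv_mem' := by
    rintro a ⟨m, hm, ha⟩
    exact ⟨m, hm, (powNormalizer f m).inv_mem ha⟩

theorem mem_elementarySubgroup {f g : G} :
    g ∈ elementarySubgroup f ↔ g ∈ elementaryClosure f := Iff.rfl

theorem self_mem_elementarySubgroup (f : G) : f ∈ elementarySubgroup f :=
  ⟨1, one_pos, Or.inl (by group)⟩

theorem mem_elementaryClosure_of_commute {f g : G} {n : ℕ} (hn : 0 < n)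
    (h : Commute g (f ^ n)) : g ∈ elementaryClosure f :=
  ⟨n, hn, Or.inl (by rw [h.eq, mul_inv_cancel_right])⟩

theorem elementaryClosure_inv (f : G) : elementaryClosure f⁻¹ = elementaryClosure f := by
  ext g
  refine exists_congr fun n => and_congr_right fun _ => ?_
  have e : g * f⁻¹ ^ n * g⁻¹ = (g * f ^ n * g⁻¹)⁻¹ := by
    rw [inv_pow]
    group
  rw [e, inv_pow, inv_inj, inv_inj]

/-- The elements of a finitely generated elementary closure normalise a common power of `f`. -/
theorem exists_elementarySubgroup_le_powNormalizer (f : G)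
    (h : (elementarySubgroup f).FG) :
    ∃ n : ℕ, 0 < n ∧ elementarySubgroup f ≤ powNormalizer f n := by
  obtain ⟨T, hT⟩ := h
  have hmem : ∀ t ∈ T, ∃ n : ℕ, 0 < n ∧ t ∈ powNormalizer f n := by
    intro t ht
    have : t ∈ elementarySubgroup f := hT ▸ Subgroup.subset_closure ht
    exact this
  choose! n hn hmem using hmem
  refine ⟨∏ t ∈ T, n t, Finset.prod_pos hn, ?_⟩
  rw [← hT, Subgroup.closure_le]
  intro t ht
  exact powNormalizer_le_of_dvd f (Finset.dvd_prod_of_mem n ht) (hmem t ht)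

theorem IsLoxodromic.inv [IsIsometricSMul G X] {f : G} {x₀ : X} (h : IsLoxodromic x₀ f) :
    IsLoxodromic x₀ f⁻¹ := by
  obtain ⟨τ, hτ, h⟩ := h
  exact ⟨τ, hτ, fun n => (h n).trans_eq (powDisp_inv f x₀ n).symm⟩

theorem IsWPD.inv [IsIsometricSMul G X] {f : G} {x₀ : X} (h : IsWPD x₀ f) :
    IsWPD x₀ f⁻¹ := by
  intro R hR
  obtain ⟨L, hL, hfin⟩ := h R hR
  refine ⟨L, hL, (hfin.image fun g => (f ^ L)⁻¹ * g * f ^ L).subset ?_⟩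
  rintro g ⟨h1, h2⟩
  refine ⟨f ^ L * g * (f ^ L)⁻¹, ⟨?_, ?_⟩, by group⟩
  · rw [← dist_smul (f ^ L), inv_pow, smul_inv_smul] at h2
    simpa only [mul_smul] using h2
  · rw [← dist_smul (f ^ L)] at h1
    simpa only [mul_smul, inv_smul_smul] using h1

/-- If `w` moves infinitely many points `f ^ s x₀` by a bounded amount, then WPD and the pigeonhole
principle make two of the conjugates `f ^ (-s) w f ^ s` equal. -/
theorem IsWPD.mem_elementaryClosure [IsIsometricSMul G X] {f w : G} {x₀ : X} (h : IsWPD x₀ f)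
    {R : ℝ} (hR : ∀ s : ℕ, dist (f ^ s • x₀) (w • f ^ s • x₀) ≤ R) :
    w ∈ elementaryClosure f := by
  have hR0 : 0 ≤ R := dist_nonneg.trans (hR 0)
  obtain ⟨L, -, hfin⟩ := h (R + 1) (by linarith)
  have hmaps : ∀ s : ℕ, (f ^ s)⁻¹ * w * f ^ s ∈ {g : G | dist x₀ (g • x₀) < R + 1 ∧
      dist (f ^ L • x₀) (g • f ^ L • x₀) < R + 1} := by
    intro s
    constructor
    · rw [← dist_smul (f ^ s), mul_assoc, mul_smul, smul_inv_smul, mul_smul]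
      linarith [hR s]
    · rw [← dist_smul (f ^ s), mul_assoc, mul_smul, smul_inv_smul, mul_smul, smul_smul, ← pow_add]
      linarith [hR (s + L)]
  obtain ⟨s, -, t, -, hst, heq⟩ :=
    Set.infinite_univ.exists_ne_map_eq_of_mapsTo (fun s _ => hmaps s) hfin
  have key : ∀ s t : ℕ, s < t → (f ^ s)⁻¹ * w * f ^ s = (f ^ t)⁻¹ * w * f ^ t →
      w ∈ elementaryClosure f := by
    intro s t hst heq
    refine mem_elementaryClosure_of_commute (Nat.sub_pos_of_lt hst) ?_
    obtain ⟨k, rfl⟩ := Nat.exists_eq_add_of_le hst.le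
    rw [Nat.add_sub_cancel_left]
    have e : f ^ (s + k) = f ^ k * f ^ s := by rw [add_comm, pow_add]
    have e2 : w = f ^ s * ((f ^ s)⁻¹ * w * f ^ s) * (f ^ s)⁻¹ := by group
    have e3 : f ^ s * ((f ^ (s + k))⁻¹ * w * f ^ (s + k)) * (f ^ s)⁻¹ =
        (f ^ k)⁻¹ * w * f ^ k := by
      rw [pow_add]
      nth_rewrite 2 [← pow_add]
      rw [e]
      group
    rw [heq, e3] at e2
    rw [commute_iff_eq]
    nth_rewrite 2 [e2]
    group
  rcases lt_or_gt_of_ne hst with h | h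
  · exact key s t h heq
  · exact key t s h heq.symm

end ElementaryClosure

/-! ### Finite index of the cyclic subgroup in the elementary closure -/

section FourPointLemmas

variable {X : Type*} [MetricSpace X] {Δ : ℝ}

/-- Two points that lie almost on a geodesic `[o, q]`, at about the same distance from `q`, are
close to each other. -/
theorem FourPoint.dist_le_of_between (hX : FourPoint Δ X) {o q y y' : X} {C e : ℝ}
    (hy : dist o y + dist y q ≤ dist o q + C) (hy' : dist o y' + dist y' q ≤ dist o q + C)
    (he : |dist y q - dist y' q| ≤ e) : dist y y' ≤ C + e + Δ := by
  obtain ⟨h1, h2⟩ := abs_le.1 he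
  have c1 := dist_comm q y'
  have c2 := dist_comm q y
  rcases hX.or o y q y' with h | h <;> linarith

/-- The property of lying almost on a geodesic `[P', Q]`, far from `P'`, is inherited by `[P, Q]`
if `P` is not too far from `P'`. -/
theorem FourPoint.between_of_dist_le (hX : FourPoint Δ X) {p P P' Q : X} {C M : ℝ}
    (h : dist P' p + dist p Q ≤ dist P' Q + C) (hM : dist P P' ≤ M)
    (hfar : C + 2 * M + Δ < 2 * dist P' p) :
    dist P p + dist p Q ≤ dist P Q + (C + Δ) := by
  have t := dist_triangle_left P' p P
  have c1 := dist_comm p P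
  have c2 := dist_comm p P'
  rcases hX.or p P' P Q with h' | h' <;> have c3 := dist_comm P' P <;> linarith

end FourPointLemmas

section FiniteIndex

variable {G X : Type*} [Group G] [MetricSpace X] [MulAction G X] [IsIsometricSMul G X]
  {Δ K : ℝ} {f : G} {x₀ : X}

/-- A point almost on a geodesic between two orbit points is close to the orbit: the displacement
`powDisp f x₀ j` runs through all values in steps of at most `powDisp f x₀ 1`. -/
theorem OrbitDefect.exists_pow_near (hX : FourPoint Δ X) (hΔ : 0 ≤ Δ) (hK : OrbitDefect f x₀ K)
    (hf : IsLoxodromic x₀ f) {p : X} {C : ℝ} {N : ℕ}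
    (hp : dist x₀ p + dist p (f ^ N • x₀) ≤ powDisp f x₀ N + C) :
    ∃ j : ℕ, dist p (f ^ j • x₀) ≤ C + K + powDisp f x₀ 1 + Δ := by
  classical
  have hK0 := hK.nonneg
  have h10 := powDisp_nonneg f x₀ 1
  have hC0 : 0 ≤ C := by
    have : powDisp f x₀ N ≤ dist x₀ p + dist p (f ^ N • x₀) := dist_triangle _ _ _
    linarith
  have hex : ∃ j : ℕ, dist x₀ p ≤ powDisp f x₀ j := by
    obtain ⟨j, hj⟩ := hf.exists_forall_ge_powDisp (dist x₀ p)
    exact ⟨j, hj j le_rfl⟩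
  obtain ⟨hj, hmin⟩ := (Nat.find_eq_iff hex).1 rfl
  generalize Nat.find hex = j at hj hmin
  have hj' : powDisp f x₀ j ≤ dist x₀ p + powDisp f x₀ 1 := by
    rcases j with _ | j
    · have : powDisp f x₀ 0 = 0 := by simp [powDisp]
      have : 0 ≤ dist x₀ p := dist_nonneg
      linarith
    · have h1 := hmin j (Nat.lt_succ_self j)
      have h2 := powDisp_add_le f x₀ j 1
      linarith
  rcases le_or_gt j N with hjN | hjN
  · refine ⟨j, ?_⟩
    obtain ⟨k, rfl⟩ := Nat.exists_eq_add_of_le hjN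
    have e := dist_mul_pow_smul 1 f x₀ j k
    rw [one_mul, one_mul] at e
    have hd := hK j k
    have hd' := powDisp_add_le f x₀ j k
    have e0 : ∀ i, dist x₀ (f ^ i • x₀) = powDisp f x₀ i := fun _ => rfl
    have c := dist_comm (f ^ (j + k) • x₀) p
    -- Both points are compared by their distances to `x₀`.
    refine hX.dist_le_of_between (o := f ^ (j + k) • x₀) (q := x₀) (C := C + K) ?_ ?_ ?_
    · rw [dist_comm (f ^ (j + k) • x₀) x₀, e0, c, dist_comm p x₀]
      linarith
    · rw [dist_comm _ x₀, dist_comm _ x₀, e0, e0, dist_comm (f ^ (j + k) • x₀), e]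
      linarith
    · rw [dist_comm p x₀, dist_comm _ x₀, e0, abs_le]
      constructor <;> linarith
  · refine ⟨N, ?_⟩
    have := hmin N hjN
    linarith

/-- If `g` normalises a power of `f`, then the axes of `f` and `g f g⁻¹` have bounded Hausdorff
distance, hence `g x₀` is close to the orbit of `x₀` under `f`, by a bound independent of `g`. -/
theorem OrbitDefect.exists_zpow_near (hX : FourPoint Δ X) (hΔ : 0 ≤ Δ) (hK : OrbitDefect f x₀ K)
    (hf : IsLoxodromic x₀ f) {n : ℕ} (hn : 0 < n) {g : G} (hg : g ∈ powNormalizer f n) :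
    ∃ j : ℤ, dist (g • x₀) (f ^ j • x₀) ≤ K + Δ + Δ + K + powDisp f x₀ 1 + Δ := by
  set M := dist x₀ (g • x₀) with hM
  obtain ⟨k, hk⟩ := hf.exists_forall_ge_powDisp (K + Δ + 2 * M + Δ + 1)
  obtain ⟨N, hN, hgN⟩ : ∃ N, k ≤ N ∧ g ∈ powNormalizer f N :=
    ⟨n * k, Nat.le_mul_of_pos_left k hn, powNormalizer_le_of_dvd f (dvd_mul_right n k) hg⟩
  have haN := hk N hN
  have hM0 : 0 ≤ M := dist_nonneg
  have hK0 := hK.nonneg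
  have eQ : dist (g • x₀) (g • f ^ N • x₀) = powDisp f x₀ N := by rw [dist_smul, powDisp]
  have eP : dist (g • (f ^ N)⁻¹ • x₀) (g • x₀) = powDisp f x₀ N := by
    rw [dist_smul, ← dist_smul (f ^ N), smul_inv_smul, powDisp]
  have ePQ' : dist ((f ^ N)⁻¹ • x₀) (f ^ N • x₀) = powDisp f x₀ (N + N) := by
    rw [← dist_smul (f ^ N), smul_inv_smul, smul_smul, ← pow_add, powDisp]
  have ePQ : dist (g • (f ^ N)⁻¹ • x₀) (g • f ^ N • x₀) = powDisp f x₀ (N + N) := by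
    rw [dist_smul, ePQ']
  have hbetween : ∀ A B : X, dist A (g • (f ^ N)⁻¹ • x₀) = M → dist B (g • f ^ N • x₀) = M →
      dist A (g • x₀) + dist (g • x₀) B ≤ dist A B + (K + Δ + Δ) := by
    intro A B hA hB
    have h1 := hX.between_of_dist_le (p := g • x₀) (P' := g • (f ^ N)⁻¹ • x₀)
      (Q := g • f ^ N • x₀) (C := K) (by rw [eP, eQ, ePQ]; exact hK N N) hA.le
      (by rw [eP]; linarith)
    have h2 := hX.between_of_dist_le (p := g • x₀) (P' := g • f ^ N • x₀) (P := B) (Q := A)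
      (C := K + Δ) (by rw [dist_comm _ (g • x₀), dist_comm _ A, dist_comm _ A]; linarith) hB.le
      (by rw [dist_comm, eQ]; linarith)
    rw [dist_comm A B, dist_comm A, dist_comm _ B]
    linarith
  have hmain : dist ((f ^ N)⁻¹ • x₀) (g • x₀) + dist (g • x₀) (f ^ N • x₀) ≤
      powDisp f x₀ (N + N) + (K + Δ + Δ) := by
    rcases hgN with h | h
    · have hc : g * f ^ N = f ^ N * g := mul_inv_eq_iff_eq_mul.1 h
      have hc' : g * (f ^ N)⁻¹ = (f ^ N)⁻¹ * g := by
        rw [eq_inv_mul_iff_mul_eq, ← mul_assoc, ← hc, mul_inv_cancel_right]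
      rw [← ePQ']
      apply hbetween
      · rw [smul_smul, hc', mul_smul, dist_smul]
      · rw [smul_smul, hc, mul_smul, dist_smul]
    · have hc : g * f ^ N = (f ^ N)⁻¹ * g := mul_inv_eq_iff_eq_mul.1 h
      have hc' : g * (f ^ N)⁻¹ = f ^ N * g := by
        rw [← inv_inj, mul_inv_rev, mul_inv_rev, inv_inv, eq_comm, inv_mul_eq_iff_eq_mul,
          ← mul_assoc, hc, mul_assoc, mul_inv_cancel, mul_one]
      rw [← ePQ', dist_comm _ (g • x₀), dist_comm (g • x₀) (f ^ N • x₀),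
        dist_comm _ (f ^ N • x₀), add_comm (dist (g • x₀) _)]
      apply hbetween
      · rw [smul_smul, hc', mul_smul, dist_smul]
      · rw [smul_smul, hc, mul_smul, dist_smul]
  obtain ⟨j, hj⟩ := hK.exists_pow_near hX hΔ hf (p := f ^ N • g • x₀) (C := K + Δ + Δ)
    (N := N + N) (by
      rw [pow_add, mul_smul, dist_smul]
      refine le_trans (le_of_eq ?_) hmain
      rw [← dist_smul (f ^ N) ((f ^ N)⁻¹ • x₀), smul_inv_smul])
  refine ⟨(j : ℤ) - N, ?_⟩
  rw [← dist_smul (f ^ N), smul_smul (f ^ N) (f ^ _)]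
  have : f ^ N * f ^ ((j : ℤ) - N) = f ^ j := by
    rw [← zpow_natCast f N, ← zpow_add, add_sub_cancel, zpow_natCast]
  rwa [this]

/-- By WPD, the centraliser of a power of `f` acts properly on the orbit of `x₀`. -/
theorem IsWPD.finite_commute (hf : IsWPD x₀ f) {n : ℕ} (hn : 0 < n) (R : ℝ) :
    {g : G | g * f ^ n * g⁻¹ = f ^ n ∧ dist x₀ (g • x₀) ≤ R}.Finite := by
  rcases lt_or_ge R 0 with hR | hR
  · refine Set.finite_empty.subset ?_
    rintro g ⟨-, hg⟩
    exact absurd (dist_nonneg.trans hg) (not_le.2 hR)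
  have h1 := powDisp_nonneg f x₀ 1
  obtain ⟨L, -, hfin⟩ := hf (R + 2 * (n * powDisp f x₀ 1) + 1) (by positivity)
  refine hfin.subset ?_
  rintro g ⟨hg, hgR⟩
  refine ⟨by have : 0 ≤ n * powDisp f x₀ 1 := by positivity
             linarith, ?_⟩
  -- `f ^ L x₀` is close to the point `f ^ (n * (L / n)) x₀`, which `g` moves as much as `x₀`.
  have hL := Nat.div_add_mod L n
  set F := f ^ (n * (L / n)) with hF
  have hgF : g * F = F * g := by
    have : g * F * g⁻¹ = F := by rw [hF, pow_mul, ← conj_pow, hg]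
    nth_rewrite 2 [← this]
    group
  have e1 : dist (F • x₀) (g • F • x₀) = dist x₀ (g • x₀) := by
    rw [smul_smul, hgF, mul_smul, dist_smul]
  have e2 : dist (F • x₀) (f ^ L • x₀) ≤ n * powDisp f x₀ 1 := by
    have e := dist_mul_pow_smul 1 f x₀ (n * (L / n)) (L % n)
    rw [one_mul, one_mul, hL] at e
    rw [hF, e]
    refine (powDisp_le_mul f x₀ _).trans ?_
    gcongr
    exact (Nat.mod_lt _ hn).le
  have t1 := dist_triangle4 (f ^ L • x₀) (F • x₀) (g • F • x₀) (g • f ^ L • x₀)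
  rw [dist_smul g, dist_comm _ (F • x₀), e1] at t1
  linarith

theorem IsWPD.finite_powNormalizer (hf : IsWPD x₀ f) {n : ℕ} (hn : 0 < n) (R : ℝ) :
    {g : G | g ∈ powNormalizer f n ∧ dist x₀ (g • x₀) ≤ R}.Finite := by
  have hinv : {g : G | g * f ^ n * g⁻¹ = (f ^ n)⁻¹ ∧ dist x₀ (g • x₀) ≤ R}.Finite := by
    -- The quotient of two elements that invert `f ^ n` commutes with `f ^ n`.
    rcases Set.eq_empty_or_nonempty {g : G | g * f ^ n * g⁻¹ = (f ^ n)⁻¹ ∧ dist x₀ (g • x₀) ≤ R}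
      with h | ⟨g₀, hg₀, hR₀⟩
    · rw [h]
      exact Set.finite_empty
    · refine ((hf.finite_commute hn (R + R)).image fun g => g₀ * g).subset ?_
      rintro g ⟨hg, hR⟩
      refine ⟨g₀⁻¹ * g, ⟨?_, ?_⟩, by group⟩
      · have e : g₀⁻¹ * g * f ^ n * (g₀⁻¹ * g)⁻¹ = g₀⁻¹ * (g * f ^ n * g⁻¹) * g₀ := by group
        rw [e, hg, ← hg₀]
        group
      · rw [← dist_smul g₀, mul_smul, smul_inv_smul]
        exact (dist_triangle_left _ _ x₀).trans (add_le_add hR₀ hR)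
  refine ((hf.finite_commute hn R).union hinv).subset ?_
  rintro g ⟨hg | hg, hR⟩
  · exact Or.inl ⟨hg, hR⟩
  · exact Or.inr ⟨hg, hR⟩

/-- If the elementary closure has finite index, then the cyclic group generated by `f` has finite
index as well. -/
theorem isVirtuallyCyclic_of_finiteIndex (hX : FourPoint Δ X) (hΔ : 0 ≤ Δ)
    (hK : OrbitDefect f x₀ K) (hf : IsLoxodromic x₀ f) (hwpd : IsWPD x₀ f) [Group.FG G]
    (hE : (elementarySubgroup f).FiniteIndex) : IsVirtuallyCyclic G := by
  obtain ⟨n, hn, hle⟩ := exists_elementarySubgroup_le_powNormalizer f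
    ((Group.fg_iff_subgroup_fg _).1 (Subgroup.fg_of_index_ne_zero (elementarySubgroup f)))
  set E := elementarySubgroup f with hEdef
  have hzle : Subgroup.zpowers f ≤ E := by
    rw [Subgroup.zpowers_le]
    exact self_mem_elementarySubgroup f
  refine ⟨Subgroup.zpowers f, inferInstance, ?_⟩
  set T : Set G := {g : G | g ∈ powNormalizer f n ∧
    dist x₀ (g • x₀) ≤ K + Δ + Δ + K + powDisp f x₀ 1 + Δ} with hT
  have hTfin : T.Finite := hwpd.finite_powNormalizer hn _
  have hcover : ∀ g ∈ E, ∃ t ∈ T, t * g ∈ Subgroup.zpowers f := by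
    intro g hg
    obtain ⟨j, hj⟩ := hK.exists_zpow_near hX hΔ hf hn (hle (E.inv_mem hg))
    refine ⟨f ^ (-j) * g⁻¹, ⟨?_, ?_⟩, ⟨-j, by simp⟩⟩
    · exact hle (E.mul_mem (E.zpow_mem (self_mem_elementarySubgroup f) _) (E.inv_mem hg))
    · rw [mul_smul, ← dist_smul (f ^ j), smul_smul (f ^ j), ← zpow_add, add_neg_cancel, zpow_zero,
        one_smul, dist_comm]
      exact hj
  have hrel : (Subgroup.zpowers f).relIndex E ≠ 0 := by
    have : Finite (E ⧸ (Subgroup.zpowers f).subgroupOf E) := by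
      choose! t ht htg using hcover
      have hTf : Finite T := hTfin
      refine Finite.of_injective
        (fun q : E ⧸ (Subgroup.zpowers f).subgroupOf E => (⟨t q.out, ht _ q.out.2⟩ : T)) ?_
      intro q q' hqq
      have hqq' : t q.out = t q'.out := congrArg Subtype.val hqq
      rw [← q.out_eq', ← q'.out_eq']
      rw [QuotientGroup.eq, Subgroup.mem_subgroupOf]
      have h1 := htg _ q.out.2
      have h2 := htg _ q'.out.2
      rw [← hqq'] at h2
      have := (Subgroup.zpowers f).mul_mem ((Subgroup.zpowers f).inv_mem h1) h2
      have e : (t (q.out : G) * (q.out : G))⁻¹ * (t (q.out : G) * (q'.out : G)) =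
        (q.out : G)⁻¹ * (q'.out : G) := by group
      rw [e] at this
      exact this
    exact (Subgroup.finiteIndex_of_finite_quotient
      (H := (Subgroup.zpowers f).subgroupOf E)).index_ne_zero
  constructor
  rw [← Subgroup.relIndex_mul_index hzle]
  exact mul_ne_zero hrel hE.index_ne_zero

/-- In a group that is not virtually cyclic there are three elements which lie in pairwise different
left cosets of the elementary closure. -/
theorem exists_three_cosets (hX : FourPoint Δ X) (hΔ : 0 ≤ Δ)
    (hK : OrbitDefect f x₀ K) (hf : IsLoxodromic x₀ f) (hwpd : IsWPD x₀ f) [Group.FG G]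
    (hG : ¬ IsVirtuallyCyclic G) :
    ∃ c : Fin 3 → G, ∀ i j, i ≠ j → (c i)⁻¹ * c j ∉ elementaryClosure f := by
  have hinf : Infinite (G ⧸ elementarySubgroup f) := by
    rw [← not_finite_iff_infinite]
    intro hfin
    exact hG (isVirtuallyCyclic_of_finiteIndex hX hΔ hK hf hwpd
      Subgroup.finiteIndex_of_finite_quotient)
  have e : Fin 3 ↪ G ⧸ elementarySubgroup f := (Fin.valEmbedding).trans (Infinite.natEmbedding _)
  refine ⟨fun i => (e i).out, fun i j hij h => hij (e.injective ?_)⟩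
  rw [← (e i).out_eq', ← (e j).out_eq', QuotientGroup.eq]
  exact h

end FiniteIndex

/-! ### Shadows of orbit segments -/

section Shadow

variable {G X : Type*} [Group G] [MetricSpace X] [MulAction G X]

/-- The shadow of the translated orbit segment from `b x₀` to `b f ^ s x₀`: all `z` such that the
segment lies on a geodesic from `b x₀` to `z`, up to an error `κ`. -/
def orbitShadow (f : G) (x₀ : X) (b : G) (s : ℕ) (κ : ℝ) : Set X :=
  {z | dist ((b * f ^ s) • x₀) z + powDisp f x₀ s ≤ dist (b • x₀) z + κ}

variable {Δ K : ℝ} {f : G} {x₀ : X}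

theorem mem_orbitShadow {b : G} {s : ℕ} {κ : ℝ} {z : X} :
    z ∈ orbitShadow f x₀ b s κ ↔
      dist ((b * f ^ s) • x₀) z + powDisp f x₀ s ≤ dist (b • x₀) z + κ := Iff.rfl

theorem orbitShadow_mono {b : G} {s : ℕ} {κ κ' : ℝ} (h : κ ≤ κ') :
    orbitShadow f x₀ b s κ ⊆ orbitShadow f x₀ b s κ' := fun _ hz =>
  le_trans (mem_orbitShadow.1 hz) (by linarith)

variable [IsIsometricSMul G X]

theorem orbitShadow_subset_of_le (hK : OrbitDefect f x₀ K) {b : G} {s t : ℕ} (hst : s ≤ t)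
    {κ : ℝ} : orbitShadow f x₀ b t κ ⊆ orbitShadow f x₀ b s (κ + K) := by
  intro z hz
  obtain ⟨k, rfl⟩ := Nat.exists_eq_add_of_le hst
  rw [mem_orbitShadow] at hz ⊢
  have h1 := dist_triangle ((b * f ^ s) • x₀) ((b * f ^ (s + k)) • x₀) z
  rw [dist_mul_pow_smul] at h1
  have := hK s k
  linarith

/-- The points closer to `b f ^ D x₀` than to `b x₀` lie in the shadow of the first half of the
segment between these two points. -/
theorem mem_orbitShadow_of_dist_le (hX : FourPoint Δ X) (hK : OrbitDefect f x₀ K)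
    {b : G} {s D : ℕ} (hsD : s ≤ D) (hs : 2 * powDisp f x₀ s ≤ powDisp f x₀ D) {z : X}
    (hz : dist z ((b * f ^ D) • x₀) ≤ dist z (b • x₀)) :
    z ∈ orbitShadow f x₀ b s (K + Δ) := by
  obtain ⟨k, rfl⟩ := Nat.exists_eq_add_of_le hsD
  rw [mem_orbitShadow]
  have hK0 := hK.nonneg
  have hd := hK s k
  have e1 := dist_smul_mul_pow_smul b f x₀ s
  have e2 := dist_smul_mul_pow_smul b f x₀ (s + k)
  have e3 := dist_mul_pow_smul b f x₀ s k
  have c1 := dist_comm z ((b * f ^ (s + k)) • x₀)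
  have c2 := dist_comm z (b • x₀)
  rcases hX.or (b • x₀) ((b * f ^ s) • x₀) ((b * f ^ (s + k)) • x₀) z with h | h <;> linarith

/-- A point whose Gromov product with a point of the shadow is large lies in the shadow, with a
slightly larger error. -/
theorem mem_orbitShadow_of_gromovProduct (hX : FourPoint Δ X) {b : G} {s : ℕ} {κ : ℝ}
    (hκ : 0 ≤ κ) {z z' : X} (hz : z ∈ orbitShadow f x₀ b s κ)
    (h : 2 * powDisp f x₀ s ≤ dist (b • x₀) z + dist (b • x₀) z' - dist z z') :
    z' ∈ orbitShadow f x₀ b s (κ + Δ) := by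
  rw [mem_orbitShadow] at hz ⊢
  have e1 := dist_smul_mul_pow_smul b f x₀ s
  have c1 := dist_comm z' ((b * f ^ s) • x₀)
  have c2 := dist_comm z' (b • x₀)
  have c3 := dist_comm z' z
  rcases hX.or z' (b • x₀) ((b * f ^ s) • x₀) z with h' | h' <;> linarith

/-- Two shadows from `b` and `b w` can meet only if `w` moves `f ^ s x₀` by a bounded amount. -/
theorem dist_le_of_mem_orbitShadow (hX : FourPoint Δ X) {b w : G} {s : ℕ} {κ : ℝ}
    {z : X} (hz : z ∈ orbitShadow f x₀ b s κ) (hz' : z ∈ orbitShadow f x₀ (b * w) s κ) :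
    dist (f ^ s • x₀) (w • f ^ s • x₀) ≤ dist x₀ (w • x₀) + κ + Δ := by
  rw [mem_orbitShadow] at hz hz'
  rw [← dist_smul b (f ^ s • x₀), ← dist_smul b x₀]
  simp only [smul_smul, ← mul_assoc]
  have e1 := dist_smul_mul_pow_smul b f x₀ s
  have e2 := dist_smul_mul_pow_smul (b * w) f x₀ s
  have t1 := dist_triangle (b • x₀) ((b * w) • x₀) ((b * w * f ^ s) • x₀)
  have t2 := dist_triangle_left ((b * w) • x₀) z (b • x₀)
  have c1 := dist_comm z ((b * w * f ^ s) • x₀)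
  rcases hX.or (b • x₀) ((b * f ^ s) • x₀) z ((b * w * f ^ s) • x₀) with h | h <;> linarith

/-- If `z` is in the shadow of a long segment, and `o` is not in the shadow of a shorter
one, then the part of the long segment beyond the short one lies almost on a geodesic `[o, z]`. -/
theorem between_of_mem_orbitShadow (hX : FourPoint Δ X) (hK : OrbitDefect f x₀ K)
    {b : G} {s t r : ℕ} {κ : ℝ} (hst : s ≤ t) (htr : t ≤ r) {o z : X}
    (ho : o ∉ orbitShadow f x₀ b s (κ + 2 * K + Δ)) (hz : z ∈ orbitShadow f x₀ b r κ) :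
    dist o ((b * f ^ t) • x₀) + dist ((b * f ^ t) • x₀) z ≤ dist o z + (κ + K + Δ) := by
  have hzt := mem_orbitShadow.1 (orbitShadow_subset_of_le hK htr hz)
  have ho' : o ∉ orbitShadow f x₀ b t (κ + K + Δ) := fun h =>
    ho (orbitShadow_mono (by linarith) (orbitShadow_subset_of_le hK hst h))
  rw [mem_orbitShadow, not_le] at ho'
  have e1 := dist_smul_mul_pow_smul b f x₀ t
  have c1 := dist_comm o ((b * f ^ t) • x₀)
  have c2 := dist_comm o (b • x₀)
  have c3 := dist_comm ((b * f ^ t) • x₀) (b • x₀)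
  have c4 := dist_comm z (b • x₀)
  have c5 := dist_comm z ((b * f ^ t) • x₀)
  rcases hX.or o z ((b * f ^ t) • x₀) (b • x₀) with h | h <;> linarith

/-- Outside the elementary closure, `w` moves the points `f ^ s x₀` further and further away. -/
theorem exists_forall_lt_dist_smul (hX : FourPoint Δ X) (hK : OrbitDefect f x₀ K)
    (hwpd : IsWPD x₀ f) {w : G} (hw : w ∉ elementaryClosure f) (R : ℝ) :
    ∃ s₀ : ℕ, ∀ s : ℕ, s₀ ≤ s → R < dist (f ^ s • x₀) (w • f ^ s • x₀) := by
  by_contra! hcon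
  refine hw (hwpd.mem_elementaryClosure (R := dist x₀ (w • x₀) + (K + 2 * |R|) + Δ) fun i => ?_)
  obtain ⟨s, his, hs⟩ := hcon i
  have hs' := hs.trans (le_abs_self R)
  have hR := abs_nonneg R
  obtain ⟨k, rfl⟩ := Nat.exists_eq_add_of_le his
  -- The point `f ^ s x₀` lies in the shadows from `1` and from `w`.
  have hd := hK i k
  have e1 := dist_mul_pow_smul 1 f x₀ i k
  have e2 := dist_smul_mul_pow_smul 1 f x₀ (i + k)
  have e3 := dist_mul_pow_smul w f x₀ i k
  have e4 := dist_smul_mul_pow_smul w f x₀ (i + k)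
  rw [smul_smul] at hs'
  rw [one_mul] at e2
  refine dist_le_of_mem_orbitShadow hX (b := 1) (z := f ^ (i + k) • x₀) ?_ ?_
  · rw [mem_orbitShadow, e2]
    rw [one_mul (f ^ (i + k))] at e1
    rw [e1]
    linarith
  · rw [mem_orbitShadow, one_mul]
    have t1 := dist_triangle ((w * f ^ i) • x₀) ((w * f ^ (i + k)) • x₀) (f ^ (i + k) • x₀)
    have t2 := dist_triangle_right (w • x₀) ((w * f ^ (i + k)) • x₀) (f ^ (i + k) • x₀)
    have c := dist_comm ((w * f ^ (i + k)) • x₀) (f ^ (i + k) • x₀)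
    linarith

theorem disjoint_orbitShadow (hX : FourPoint Δ X) (hK : OrbitDefect f x₀ K)
    (hwpd : IsWPD x₀ f) {w : G} (hw : w ∉ elementaryClosure f) (κ : ℝ) :
    ∃ s₀ : ℕ, ∀ s : ℕ, s₀ ≤ s → ∀ (b : G) (z : X), z ∈ orbitShadow f x₀ b s κ →
      z ∉ orbitShadow f x₀ (b * w) s κ := by
  obtain ⟨s₀, hs₀⟩ := exists_forall_lt_dist_smul hX hK hwpd hw (dist x₀ (w • x₀) + κ + Δ)
  exact ⟨s₀, fun s hs b z hz hz' =>
    (hs₀ s hs).not_ge (dist_le_of_mem_orbitShadow hX hz hz')⟩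

theorem exists_halfspace_subset_orbitShadow (hX : FourPoint Δ X)
    (hK : OrbitDefect f x₀ K) (hf : IsLoxodromic x₀ f) (s : ℕ) :
    ∃ D₀ : ℕ, ∀ D : ℕ, D₀ ≤ D → ∀ (b : G) (z : X),
      dist z ((b * f ^ D) • x₀) ≤ dist z (b • x₀) → z ∈ orbitShadow f x₀ b s (K + Δ) := by
  obtain ⟨N, hN⟩ := hf.exists_forall_ge_powDisp (2 * powDisp f x₀ s)
  exact ⟨max N s, fun D hD b z hz => mem_orbitShadow_of_dist_le hX hK
    ((le_max_right _ _).trans hD) (hN D ((le_max_left _ _).trans hD)) hz⟩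

/-- For `w` outside the elementary closure and large `D`, the halfspace of points closer to
`f ^ D x₀` than to `x₀` is disjoint from its translate by `w`. -/
theorem exists_disjoint_halfspaces (hX : FourPoint Δ X)
    (hK : OrbitDefect f x₀ K) (hf : IsLoxodromic x₀ f) (hwpd : IsWPD x₀ f) {w : G}
    (hw : w ∉ elementaryClosure f) :
    ∃ D₀ : ℕ, ∀ D : ℕ, D₀ ≤ D → ∀ (b : G) (z : X),
      dist z ((b * f ^ D) • x₀) ≤ dist z (b • x₀) →
      ¬ dist z ((b * w * f ^ D) • x₀) ≤ dist z ((b * w) • x₀) := by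
  obtain ⟨s, hs⟩ := disjoint_orbitShadow hX hK hwpd hw (K + Δ)
  obtain ⟨D₀, hD₀⟩ := exists_halfspace_subset_orbitShadow hX hK hf s
  exact ⟨D₀, fun D hD b z hz hz' => hs s le_rfl b z (hD₀ D hD b z hz) (hD₀ D hD _ z hz')⟩

end Shadow

/-! ### Expansion of finite sets -/

section Expansion

variable {G X : Type*} [Group G]

/-- Ping-pong with three players forces right multiplication by three fixed elements to double the
size of every finite set: a point `v` of the set can be lost to at most one of the three players. -/
theorem two_mul_card_le_card_mul [DecidableEq G] {p : Fin 3 → G} {V V' : Fin 3 → Set G}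
    (hV : ∀ i j, i ≠ j → ∀ g ∈ V i, g ∉ V j) (hV' : ∀ i j, i ≠ j → ∀ g ∈ V' i, g ∉ V' j)
    (hp : ∀ i, ∀ g, g ∉ V' i → p i * g ∈ V i) (F : Finset G) :
    2 * F.card ≤ (F * Finset.univ.image fun i => (p i)⁻¹).card := by
  classical
  set T : Finset (Σ _ : G, Fin 3) :=
    F.sigma fun v => Finset.univ.filter fun i => v⁻¹ ∉ V' i with hT
  have h1 : 2 * F.card ≤ T.card := by
    rw [hT, Finset.card_sigma, mul_comm, ← smul_eq_mul]
    refine Finset.card_nsmul_le_sum _ _ _ fun v _ => ?_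
    have h2 := Finset.card_filter_add_card_filter_not (s := (Finset.univ : Finset (Fin 3)))
      fun i => v⁻¹ ∈ V' i
    have h3 : (Finset.univ.filter fun i => v⁻¹ ∈ V' i).card ≤ 1 := by
      refine Finset.card_le_one.2 fun i hi j hj => ?_
      by_contra hij
      exact hV' i j hij _ (Finset.mem_filter.1 hi).2 (Finset.mem_filter.1 hj).2
    rw [Finset.card_univ, Fintype.card_fin] at h2
    omega
  refine h1.trans (Finset.card_le_card_of_injOn (fun x => x.1 * (p x.2)⁻¹) ?_ ?_)
  · rintro ⟨v, i⟩ hx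
    have hv := (Finset.mem_sigma.1 hx).1
    exact Finset.mul_mem_mul hv (Finset.mem_image_of_mem _ (Finset.mem_univ i))
  · rintro ⟨v, i⟩ hx ⟨v', j⟩ hx' heq
    have hi := hp i _ (Finset.mem_filter.1 (Finset.mem_sigma.1 hx).2).2
    have hj := hp j _ (Finset.mem_filter.1 (Finset.mem_sigma.1 hx').2).2
    simp only at heq hi hj
    have e : p i * v⁻¹ = p j * v'⁻¹ := by
      rw [← inv_inj]
      simpa using heq
    have hij : i = j := by
      by_contra hij
      rw [← e] at hj
      exact hV i j hij _ hi hj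
    subst hij
    have := mul_right_cancel heq
    subst this
    rfl

theorem two_pow_mul_card_le_card_mul_pow [DecidableEq G] {P : Finset G}
    (hP : ∀ F : Finset G, 2 * F.card ≤ (F * P).card) (F : Finset G) (k : ℕ) :
    2 ^ k * F.card ≤ (F * P ^ k).card := by
  induction k with
  | zero => simp
  | succ k ih =>
    rw [pow_succ P, ← mul_assoc]
    refine le_trans ?_ (hP _)
    rw [pow_succ']
    linarith

variable [MetricSpace X] [MulAction G X] [IsIsometricSMul G X] {Δ K : ℝ} {f : G} {x₀ : X}

/-- The conjugates of a large power of `f` by representatives of three cosets of the elementary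
closure play ping-pong with halfspaces, hence `G` is nonamenable in a quantitative way. -/
theorem exists_two_mul_card_le_card_mul [DecidableEq G] (hX : FourPoint Δ X)
    (hK : OrbitDefect f x₀ K) (hf : IsLoxodromic x₀ f) (hwpd : IsWPD x₀ f) {c : Fin 3 → G}
    (hc : ∀ i j, i ≠ j → (c i)⁻¹ * c j ∉ elementaryClosure f) :
    ∃ P : Finset G, ∀ F : Finset G, 2 * F.card ≤ (F * P).card := by
  have hev : ∀ i j, ∀ᶠ D in Filter.atTop, i ≠ j → (∀ z : X,
      dist z ((c i * f ^ D) • x₀) ≤ dist z (c i • x₀) →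
        ¬ dist z ((c j * f ^ D) • x₀) ≤ dist z (c j • x₀)) ∧ ∀ z : X,
      dist z ((c i * f⁻¹ ^ D) • x₀) ≤ dist z (c i • x₀) →
        ¬ dist z ((c j * f⁻¹ ^ D) • x₀) ≤ dist z (c j • x₀) := by
    intro i j
    rcases eq_or_ne i j with rfl | hij
    · exact Filter.Eventually.of_forall fun _ h => absurd rfl h
    obtain ⟨D₁, h₁⟩ := exists_disjoint_halfspaces hX hK hf hwpd (hc i j hij)
    obtain ⟨D₂, h₂⟩ := exists_disjoint_halfspaces hX hK.inv hf.inv hwpd.inv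
      (w := (c i)⁻¹ * c j) (by rw [elementaryClosure_inv]; exact hc i j hij)
    filter_upwards [Filter.eventually_ge_atTop D₁, Filter.eventually_ge_atTop D₂] with D hD₁ hD₂ _
    have g₁ := h₁ D hD₁ (c i)
    have g₂ := h₂ D hD₂ (c i)
    rw [mul_inv_cancel_left] at g₁ g₂
    exact ⟨g₁, g₂⟩
  obtain ⟨D, hD⟩ := (Filter.eventually_all.2 fun i => Filter.eventually_all.2 (hev i)).exists
  refine ⟨Finset.univ.image fun i => (c i * f ^ D * (c i)⁻¹)⁻¹, fun F =>
    two_mul_card_le_card_mul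
      (V := fun i => {g | dist (g • x₀) ((c i * f ^ D) • x₀) ≤ dist (g • x₀) (c i • x₀)})
      (V' := fun i => {g | dist (g • x₀) ((c i * f⁻¹ ^ D) • x₀) ≤ dist (g • x₀) (c i • x₀)})
      (fun i j hij g hg => (hD i j hij).1 _ hg) (fun i j hij g hg => (hD i j hij).2 _ hg)
      (fun i g hg => ?_) F⟩
  have hg' : dist (g • x₀) (c i • x₀) < dist (g • x₀) ((c i * f⁻¹ ^ D) • x₀) := not_le.1 hg
  rw [← dist_smul (c i * f ^ D * (c i)⁻¹) (g • x₀) (c i • x₀),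
    ← dist_smul (c i * f ^ D * (c i)⁻¹) (g • x₀) ((c i * f⁻¹ ^ D) • x₀)] at hg'
  have e1 : c i * f ^ D * (c i)⁻¹ * c i = c i * f ^ D := by group
  have e2 : c i * f ^ D * (c i)⁻¹ * (c i * f⁻¹ ^ D) = c i := by
    rw [inv_pow]
    group
  rw [smul_smul, smul_smul, smul_smul, e1, e2] at hg'
  exact hg'.le

end Expansion

/-! ### Counting branch points -/

section Branching

variable {G X : Type*} [Group G] [MetricSpace X] [MulAction G X] {Δ K : ℝ} {f : G} {x₀ : X}

/-- The finite set `B` branches at `u`: it has points in the shadows of all three directions `u c i`,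
except possibly of the one that contains the basepoint. The basepoint is tested against the shadow of
a shorter segment (`s ≤ t`) with a larger error. -/
def IsBranchedAt (f : G) (x₀ : X) (c : Fin 3 → G) (s t : ℕ) (κ κ' : ℝ) (B : Finset G) (u : G) :
    Prop :=
  ∀ i, x₀ ∉ orbitShadow f x₀ (u * c i) s κ' →
    ∃ a ∈ B, a • x₀ ∈ orbitShadow f x₀ (u * c i) t κ

/-- Twice the Gromov product of `g x₀` and `a x₀` at `x₀`. -/
noncomputable def orbitGromov (x₀ : X) (g a : G) : ℝ :=
  dist x₀ (g • x₀) + dist x₀ (a • x₀) - dist (g • x₀) (a • x₀)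

variable [IsIsometricSMul G X]

/-- Suppose that adding `g` to `B` creates a branching at `u`, in direction `i`, and that `g` was
chosen in `A \ B` such that the largest Gromov product `h / 2` with elements of `B` is as small as
possible. Then the branch point lies on a geodesic from `x₀` to `g x₀`, at a distance from `x₀` that
is determined by `h` up to a constant: it cannot be farther away because a third direction at `u`
contains a point of `B`, and it cannot be nearer because otherwise each point of `A` would share
the direction `i` with a point of `B`. -/
theorem branch_position (hX : FourPoint Δ X) (hΔ : 0 ≤ Δ) (hK : OrbitDefect f x₀ K)
    {c : Fin 3 → G} {s t : ℕ} (hst : s ≤ t) {κ κ' : ℝ} (hκ : κ = K + Δ + Δ)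
    (hκ' : κ' = κ + 2 * K + Δ)
    (hdisj : ∀ i j, i ≠ j → ∀ (u : G) (z : X), z ∈ orbitShadow f x₀ (u * c i) s κ' →
      z ∉ orbitShadow f x₀ (u * c j) s κ')
    {C : ℝ} (hC : ∀ i j, dist ((c i * f ^ s) • x₀) ((c j * f ^ s) • x₀) ≤ C)
    {A B : Finset G} {u g : G} {h : ℝ} {i : Fin 3}
    (ho : x₀ ∉ orbitShadow f x₀ (u * c i) s κ')
    (hg : g • x₀ ∈ orbitShadow f x₀ (u * c i) t κ)
    (hB : ∀ a ∈ B, a • x₀ ∉ orbitShadow f x₀ (u * c i) t κ)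
    (hu : ∀ j, x₀ ∉ orbitShadow f x₀ (u * c j) s κ' →
      ∃ a, (a = g ∨ a ∈ B) ∧ a • x₀ ∈ orbitShadow f x₀ (u * c j) t κ)
    (hA : ∃ a ∈ A, a • x₀ ∈ orbitShadow f x₀ (u * c i) t (K + Δ))
    (hle : ∀ a ∈ B, orbitGromov x₀ g a ≤ h)
    (hge : ∀ a ∈ A, a ∉ B → ∃ b ∈ B, h ≤ orbitGromov x₀ a b) :
    h / 2 - powDisp f x₀ t - powDisp f x₀ s ≤ dist x₀ ((u * c i * f ^ s) • x₀) ∧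
      dist x₀ ((u * c i * f ^ s) • x₀) ≤ h / 2 + (κ + K + Δ) + C := by
  have hK0 := hK.nonneg
  have hsub : ∀ j, orbitShadow f x₀ (u * c j) t κ ⊆ orbitShadow f x₀ (u * c j) s κ' := fun j =>
    (orbitShadow_subset_of_le hK hst).trans (orbitShadow_mono (by linarith))
  constructor
  · obtain ⟨a, haA, ha⟩ := hA
    have haB : a ∉ B := fun haB => hB a haB (orbitShadow_mono (by linarith) ha)
    obtain ⟨b, hb, hab⟩ := hge a haA haB
    by_contra! hcon
    refine hB b hb (hκ ▸ mem_orbitShadow_of_gromovProduct hX (by linarith) ha ?_)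
    unfold orbitGromov at hab
    have t0 := dist_triangle_right x₀ ((u * c i) • x₀) ((u * c i * f ^ s) • x₀)
    rw [dist_smul_mul_pow_smul] at t0
    have t1 := dist_triangle x₀ ((u * c i) • x₀) (a • x₀)
    have t2 := dist_triangle x₀ ((u * c i) • x₀) (b • x₀)
    linarith
  · obtain ⟨j, hij, hj⟩ : ∃ j, i ≠ j ∧ x₀ ∉ orbitShadow f x₀ (u * c j) s κ' := by
      obtain ⟨j, k, hij, hik, hjk⟩ : ∃ j k : Fin 3, i ≠ j ∧ i ≠ k ∧ j ≠ k :=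
        (by decide : ∀ i : Fin 3, ∃ j k : Fin 3, i ≠ j ∧ i ≠ k ∧ j ≠ k) i
      by_cases hj : x₀ ∈ orbitShadow f x₀ (u * c j) s κ'
      · exact ⟨k, hik, hdisj j k hjk u x₀ hj⟩
      · exact ⟨j, hij, hj⟩
    obtain ⟨a, rfl | haB, ha⟩ := hu j hj
    · exact absurd (hsub j ha) (hdisj i j hij u _ (hsub i hg))
    have b1 := between_of_mem_orbitShadow hX hK le_rfl hst (hκ' ▸ ho) hg
    have b2 := between_of_mem_orbitShadow hX hK le_rfl hst (hκ' ▸ hj) ha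
    have h1 := hle a haB
    unfold orbitGromov at h1
    have h2 : dist ((u * c i * f ^ s) • x₀) ((u * c j * f ^ s) • x₀) ≤ C := by
      rw [mul_assoc u, mul_assoc u, mul_smul u, mul_smul u, dist_smul]
      exact hC i j
    have t1 := dist_triangle4 (g • x₀) ((u * c i * f ^ s) • x₀) ((u * c j * f ^ s) • x₀) (a • x₀)
    have t2 := dist_triangle_right x₀ ((u * c i * f ^ s) • x₀) ((u * c j * f ^ s) • x₀)
    have c1 := dist_comm (g • x₀) ((u * c i * f ^ s) • x₀)
    linarith

/-- Two translated orbit segments of length `L` that lie on the geodesic from `x₀` to `g x₀` at the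
same place differ by an element that moves both `x₀` and `f ^ L x₀` by a bounded amount. -/
theorem dist_lt_of_same_position (hX : FourPoint Δ X) (hK : OrbitDefect f x₀ K)
    {s L : ℕ} {κ κ' R : ℝ} (hκ' : κ' = κ + 2 * K + Δ) (hκ : 0 ≤ κ)
    (hR : R = (κ + K + Δ) + (1 + κ + K) + Δ + 1) {b b' g : G}
    (ho : x₀ ∉ orbitShadow f x₀ b s κ') (hg : g • x₀ ∈ orbitShadow f x₀ b (s + L) κ)
    (ho' : x₀ ∉ orbitShadow f x₀ b' s κ') (hg' : g • x₀ ∈ orbitShadow f x₀ b' (s + L) κ)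
    (hpos : |dist ((b * f ^ s) • x₀) (g • x₀) - dist ((b' * f ^ s) • x₀) (g • x₀)| ≤ 1) :
    (b * f ^ s)⁻¹ * (b' * f ^ s) ∈ {w : G | dist x₀ (w • x₀) < R ∧
      dist (f ^ L • x₀) (w • f ^ L • x₀) < R} := by
  have hK0 := hK.nonneg
  subst hκ'
  obtain ⟨p1, p2⟩ := abs_le.1 hpos
  have hsL : s ≤ s + L := Nat.le_add_right s L
  have key : ∀ b : G, g • x₀ ∈ orbitShadow f x₀ b (s + L) κ →
      dist ((b * f ^ (s + L)) • x₀) (g • x₀) + powDisp f x₀ L ≤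
        dist ((b * f ^ s) • x₀) (g • x₀) + κ + K ∧
      dist ((b * f ^ s) • x₀) (g • x₀) ≤
        powDisp f x₀ L + dist ((b * f ^ (s + L)) • x₀) (g • x₀) := by
    intro b hg
    rw [mem_orbitShadow] at hg
    have t1 := dist_triangle ((b * f ^ s) • x₀) ((b * f ^ (s + L)) • x₀) (g • x₀)
    have t2 := dist_triangle (b • x₀) ((b * f ^ s) • x₀) (g • x₀)
    rw [dist_mul_pow_smul] at t1
    rw [dist_smul_mul_pow_smul] at t2
    have := hK s L
    constructor <;> linarith
  obtain ⟨k1, k2⟩ := key b hg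
  obtain ⟨k1', k2'⟩ := key b' hg'
  constructor
  · rw [← dist_smul (b * f ^ s), smul_smul, mul_inv_cancel_left]
    have := hX.dist_le_of_between (between_of_mem_orbitShadow hX hK le_rfl hsL ho hg)
      (between_of_mem_orbitShadow hX hK le_rfl hsL ho' hg') hpos
    linarith
  · rw [← dist_smul (b * f ^ s), smul_smul, smul_smul, smul_smul,
      mul_inv_cancel_left, mul_assoc b, mul_assoc b', ← pow_add]
    have := hX.dist_le_of_between (e := 1 + κ + K)
      (between_of_mem_orbitShadow hX hK hsL le_rfl ho hg)
      (between_of_mem_orbitShadow hX hK hsL le_rfl ho' hg')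
      (abs_le.2 ⟨by linarith, by linarith⟩)
    linarith

/-- The number of `u` in all three of whose directions the finite set `A` has points is at most
proportional to the size of `A`, as for branch points and leaves of a tree. -/
theorem exists_card_le_mul_card (hX : FourPoint Δ X) (hΔ : 0 ≤ Δ) (hK : OrbitDefect f x₀ K)
    (hwpd : IsWPD x₀ f) {c : Fin 3 → G}
    (hc : ∀ i j, i ≠ j → (c i)⁻¹ * c j ∉ elementaryClosure f) :
    ∃ t N : ℕ, ∀ A F : Finset G,
      (∀ u ∈ F, ∀ i, ∃ a ∈ A, a • x₀ ∈ orbitShadow f x₀ (u * c i) t (K + Δ)) →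
      F.card ≤ N * A.card := by
  classical
  have hK0 := hK.nonneg
  obtain ⟨κ, hκ⟩ : ∃ κ, κ = K + Δ + Δ := ⟨_, rfl⟩
  obtain ⟨κ', hκ'⟩ : ∃ κ', κ' = κ + 2 * K + Δ := ⟨_, rfl⟩
  obtain ⟨R, hR⟩ : ∃ R, R = (κ + K + Δ) + (1 + κ + K) + Δ + 1 := ⟨_, rfl⟩
  have hκ0 : 0 ≤ κ := by linarith
  obtain ⟨L, -, hW⟩ := hwpd R (by linarith)
  obtain ⟨s, hdisj⟩ : ∃ s, ∀ i j, i ≠ j → ∀ (u : G) (z : X),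
      z ∈ orbitShadow f x₀ (u * c i) s κ' → z ∉ orbitShadow f x₀ (u * c j) s κ' := by
    have hev : ∀ i j, ∀ᶠ s in Filter.atTop, i ≠ j → ∀ (u : G) (z : X),
        z ∈ orbitShadow f x₀ (u * c i) s κ' → z ∉ orbitShadow f x₀ (u * c j) s κ' := by
      intro i j
      rcases eq_or_ne i j with rfl | hij
      · exact Filter.Eventually.of_forall fun _ h => absurd rfl h
      obtain ⟨s₀, hs₀⟩ := disjoint_orbitShadow hX hK hwpd (hc i j hij) κ'
      filter_upwards [Filter.eventually_ge_atTop s₀] with s hs _ u z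
      have := hs₀ s hs (u * c i) z
      rwa [mul_assoc u, mul_inv_cancel_left] at this
    exact (Filter.eventually_all.2 fun i => Filter.eventually_all.2 (hev i)).exists
  obtain ⟨C, hC⟩ : ∃ C : ℝ, ∀ i j, dist ((c i * f ^ s) • x₀) ((c j * f ^ s) • x₀) ≤ C := by
    obtain ⟨C, hC⟩ := (Set.finite_range fun p : Fin 3 × Fin 3 =>
      dist ((c p.1 * f ^ s) • x₀) ((c p.2 * f ^ s) • x₀)).bddAbove
    exact ⟨C, fun i j => hC ⟨(i, j), rfl⟩⟩
  have hst : s ≤ s + L := Nat.le_add_right s L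
  set W : Finset G := hW.toFinset with hWdef
  set l : ℝ := 2 * (κ + K + Δ) + C + powDisp f x₀ (s + L) + powDisp f x₀ s with hl
  set N : ℕ := W.card * (3 * (⌊l⌋₊ + 1)) with hN
  refine ⟨s + L, N, fun A F hF => ?_⟩
  set P := IsBranchedAt f x₀ c s (s + L) κ κ' with hP
  -- Adding a suitable element of `A` to `B` creates at most `N` new branchings.
  have hstep : ∀ B ⊆ A, B.Nonempty → B.card < A.card →
      ∃ g ∈ A, g ∉ B ∧ ((F.filter fun u => P (insert g B) u).card ≤
        (F.filter fun u => P B u).card + N) := by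
    intro B hBA hBne hcard
    have hne : (A \ B).Nonempty := by
      rw [← Finset.card_pos, Finset.card_sdiff_of_subset hBA]
      omega
    obtain ⟨g, hgAB, hmin⟩ := Finset.exists_min_image (A \ B)
      (fun g => B.sup' hBne (orbitGromov x₀ g)) hne
    obtain ⟨hgA, hgB⟩ := Finset.mem_sdiff.1 hgAB
    refine ⟨g, hgA, hgB, ?_⟩
    set h := B.sup' hBne (orbitGromov x₀ g) with hh
    have hle : ∀ a ∈ B, orbitGromov x₀ g a ≤ h := fun a ha => Finset.le_sup' _ ha
    have hge : ∀ a ∈ A, a ∉ B → ∃ b ∈ B, h ≤ orbitGromov x₀ a b := by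
      intro a haA haB
      have h1 := hmin a (Finset.mem_sdiff.2 ⟨haA, haB⟩)
      obtain ⟨b, hb, hb'⟩ := Finset.exists_mem_eq_sup' hBne (orbitGromov x₀ a)
      exact ⟨b, hb, h1.trans hb'.le⟩
    set S := (F.filter fun u => P (insert g B) u).filter fun u => ¬ P B u with hS
    have hsplit : (F.filter fun u => P (insert g B) u).card ≤
        (F.filter fun u => P B u).card + S.card := by
      refine (Finset.card_le_card ?_).trans (Finset.card_union_le _ _)
      intro u hu
      by_cases hB : P B u
      · exact Finset.mem_union_left _ (Finset.mem_filter.2 ⟨(Finset.mem_filter.1 hu).1, hB⟩)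
      · exact Finset.mem_union_right _ (Finset.mem_filter.2 ⟨hu, hB⟩)
    refine hsplit.trans (Nat.add_le_add_left ?_ _)
    have hnew : ∀ u ∈ S, ∃ i, x₀ ∉ orbitShadow f x₀ (u * c i) s κ' ∧
        g • x₀ ∈ orbitShadow f x₀ (u * c i) (s + L) κ ∧
        h / 2 - powDisp f x₀ (s + L) - powDisp f x₀ s ≤ dist x₀ ((u * c i * f ^ s) • x₀) ∧
        dist x₀ ((u * c i * f ^ s) • x₀) ≤ h / 2 + (κ + K + Δ) + C := by
      intro u hu
      obtain ⟨hu1, huB⟩ := Finset.mem_filter.1 hu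
      obtain ⟨huF, hug⟩ := Finset.mem_filter.1 hu1
      simp only [hP, IsBranchedAt, not_forall, not_exists, not_and] at huB
      obtain ⟨i, ho, hB⟩ := huB
      have hg : g • x₀ ∈ orbitShadow f x₀ (u * c i) (s + L) κ := by
        obtain ⟨a, ha, ha'⟩ := hug i ho
        rcases Finset.mem_insert.1 ha with rfl | haB
        · exact ha'
        · exact absurd ha' (hB a haB)
      refine ⟨i, ho, hg, branch_position hX hΔ hK hst hκ hκ' hdisj hC ho hg hB ?_ (hF u huF i)
        hle hge⟩
      intro j hj
      obtain ⟨a, ha, ha'⟩ := hug j hj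
      exact ⟨a, Finset.mem_insert.1 ha, ha'⟩
    choose! i hio hig hilow hiup using hnew
    -- The new `u` are sorted by the direction `i u` and by the rounded position of the segment
    -- on the geodesic from `x₀` to `g x₀`.
    set y : G → X := fun u => (u * c (i u) * f ^ s) • x₀ with hy
    set lo : ℝ := dist x₀ (g • x₀) - h / 2 - (κ + K + Δ) - C with hlo
    have hpos : ∀ u ∈ S, 0 ≤ dist (y u) (g • x₀) - lo ∧ dist (y u) (g • x₀) - lo ≤ l := by
      intro u hu
      have h1 := between_of_mem_orbitShadow hX hK le_rfl hst (hκ' ▸ hio u hu) (hig u hu)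
      have h2 := dist_triangle x₀ (y u) (g • x₀)
      have h3 := hilow u hu
      have h4 := hiup u hu
      simp only [hy] at h2 ⊢
      constructor <;> linarith
    have hmaps : ∀ u ∈ S, (i u, ⌊dist (y u) (g • x₀) - lo⌋₊) ∈
        (Finset.univ : Finset (Fin 3)) ×ˢ Finset.range (⌊l⌋₊ + 1) := by
      intro u hu
      refine Finset.mem_product.2 ⟨Finset.mem_univ _, Finset.mem_range.2 (Nat.lt_succ_of_le ?_)⟩
      exact Nat.floor_le_floor (hpos u hu).2
    have hcardle := Finset.card_le_mul_card_image_of_maps_to hmaps W.card ?_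
    · rwa [Finset.card_product, Finset.card_univ, Fintype.card_fin, Finset.card_range] at hcardle
    · intro q _
      rcases Finset.eq_empty_or_nonempty
        (S.filter fun u => (i u, ⌊dist (y u) (g • x₀) - lo⌋₊) = q) with hemp | ⟨v, hv⟩
      · rw [hemp, Finset.card_empty]
        exact Nat.zero_le _
      obtain ⟨hvS, rfl⟩ := Finset.mem_filter.1 hv
      refine Finset.card_le_card_of_injOn
        (fun u => (v * c (i v) * f ^ s)⁻¹ * (u * c (i v) * f ^ s)) ?_ ?_
      · intro u hu
        obtain ⟨huS, hq⟩ := Finset.mem_filter.1 hu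
        obtain ⟨hiu, hfl⟩ := Prod.mk.inj hq
        have hou := hio u huS
        have hgu := hig u huS
        rw [hiu] at hou hgu
        have f1 := Nat.floor_le (hpos u huS).1
        have f2 := Nat.lt_floor_add_one (dist (y u) (g • x₀) - lo)
        have f3 := Nat.floor_le (hpos v hvS).1
        have f4 := Nat.lt_floor_add_one (dist (y v) (g • x₀) - lo)
        rw [hfl] at f1 f2
        simp only [hy, hiu] at f1 f2 f3 f4
        refine hW.mem_toFinset.2 (dist_lt_of_same_position hX hK hκ' hκ0 hR (hio v hvS)
          (hig v hvS) hou hgu (abs_le.2 ⟨?_, ?_⟩)) <;> linarith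
      · intro u _ u' _ huu
        simpa using huu
  -- The induction starts with one element, which cannot lie in two disjoint shadows.
  have hind : ∀ n : ℕ, n + 1 ≤ A.card → ∃ B ⊆ A, B.card = n + 1 ∧
      (F.filter fun u => P B u).card ≤ N * (n + 1) := by
    intro n
    induction n with
    | zero =>
      intro hn
      obtain ⟨a, ha⟩ := Finset.card_pos.1 hn
      refine ⟨{a}, Finset.singleton_subset_iff.2 ha, Finset.card_singleton a, ?_⟩
      rw [Finset.filter_false_of_mem, Finset.card_empty]
      · exact Nat.zero_le _
      intro u _ hu
      have hsub : ∀ j, orbitShadow f x₀ (u * c j) (s + L) κ ⊆ orbitShadow f x₀ (u * c j) s κ' :=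
        fun j => (orbitShadow_subset_of_le hK hst).trans (orbitShadow_mono (by linarith))
      obtain ⟨j, k, hjk, hj, hk⟩ : ∃ j k, j ≠ k ∧ x₀ ∉ orbitShadow f x₀ (u * c j) s κ' ∧
          x₀ ∉ orbitShadow f x₀ (u * c k) s κ' := by
        by_cases h0 : x₀ ∈ orbitShadow f x₀ (u * c 0) s κ'
        · exact ⟨1, 2, by decide, hdisj 0 1 (by decide) u _ h0, hdisj 0 2 (by decide) u _ h0⟩
        by_cases h1 : x₀ ∈ orbitShadow f x₀ (u * c 1) s κ'
        · exact ⟨0, 2, by decide, h0, hdisj 1 2 (by decide) u _ h1⟩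
        · exact ⟨0, 1, by decide, h0, h1⟩
      obtain ⟨b, hb, hb'⟩ := hu j hj
      obtain ⟨d, hd, hd'⟩ := hu k hk
      rw [Finset.mem_singleton] at hb hd
      subst hb
      subst hd
      exact hdisj j k hjk u _ (hsub j hb') (hsub k hd')
    | succ n ih =>
      intro hn
      obtain ⟨B, hBA, hBcard, hB⟩ := ih (by omega)
      obtain ⟨g, hgA, hgB, hg⟩ := hstep B hBA (Finset.card_pos.1 (by omega)) (by omega)
      refine ⟨insert g B, Finset.insert_subset hgA hBA, ?_, ?_⟩
      · rw [Finset.card_insert_of_notMem hgB, hBcard]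
      · rw [mul_add N, mul_one]
        omega
  rcases Nat.eq_zero_or_pos A.card with hA0 | hApos
  · have hFe : F = ∅ := by
      rw [Finset.card_eq_zero] at hA0
      subst hA0
      refine Finset.eq_empty_of_forall_notMem fun u hu => ?_
      obtain ⟨a, ha, -⟩ := hF u hu 0
      exact Finset.notMem_empty a ha
    simp [hFe]
  · obtain ⟨B, hBA, hBcard, hB⟩ := hind (A.card - 1) (by omega)
    have hBA' : B = A := Finset.eq_of_subset_of_card_le hBA (by omega)
    rw [Nat.sub_add_cancel hApos, hBA', Finset.filter_true_of_mem] at hB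
    · exact hB
    · intro u hu i _
      obtain ⟨a, ha, ha'⟩ := hF u hu i
      exact ⟨a, ha, orbitShadow_mono (by linarith) ha'⟩

end Branching

/-! ### Supporting halfspaces -/

section Supporting

variable {G X : Type*} [Group G] [MetricSpace X] [MulAction G X]

theorem wordDist_mul_right (S : Set G) (a x : G) : wordDist S a (a * x) = wordNorm S x := by
  simp only [wordDist, wordNorm, mul_right_inj, one_mul]

theorem exists_forall_wordNorm_le (S : Set G) (Q : Finset G) :
    ∃ N : ℕ, ∀ x ∈ Q, wordNorm S x ≤ N :=
  ⟨Q.sup (wordNorm S), fun _ hx => Finset.le_sup (f := wordNorm S) hx⟩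

variable [IsIsometricSMul G X] {Δ K : ℝ} {f : G} {x₀ : X}

/-- The points of `A` near which no halfspace contains `A` spread, by expansion, to a set that is
`2 ^ k` times larger, all of whose elements see `A` in three directions; the size of the latter set
is at most a constant times that of `A`. -/
theorem exists_supporting_halfspaces (hX : FourPoint Δ X) (hΔ : 0 ≤ Δ) (hK : OrbitDefect f x₀ K)
    (hf : IsLoxodromic x₀ f) (hwpd : IsWPD x₀ f) {c : Fin 3 → G}
    (hc : ∀ i j, i ≠ j → (c i)⁻¹ * c j ∉ elementaryClosure f) :
    ∃ D₀ : ℕ, ∀ ε : ℝ, 0 < ε → ∃ Q : Finset G, ∀ D : ℕ, D₀ ≤ D → ∀ A : Finset G,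
      ∃ A' : Finset G, A' ⊆ A ∧ (1 - ε) * (A.card : ℝ) ≤ (A'.card : ℝ) ∧
        ∀ a ∈ A', ∃ x ∈ Q, ∀ g ∈ A,
          g • x₀ ∈ halfspace ((a * x) • x₀) ((a * x * f ^ D) • x₀) := by
  classical
  obtain ⟨t, N, hN⟩ := exists_card_le_mul_card hX hΔ hK hwpd hc
  obtain ⟨P, hP⟩ := exists_two_mul_card_le_card_mul hX hK hf hwpd hc
  obtain ⟨D₀, hD₀⟩ := exists_halfspace_subset_orbitShadow hX hK hf t
  refine ⟨D₀, fun ε hε => ?_⟩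
  obtain ⟨k, hk⟩ : ∃ k : ℕ, (N : ℝ) / ε < 2 ^ k := pow_unbounded_of_one_lt _ one_lt_two
  rw [div_lt_iff₀ hε] at hk
  refine ⟨P ^ k * Finset.univ.image c, fun D hD A => ?_⟩
  set Good : G → Prop := fun a => ∃ x ∈ P ^ k * Finset.univ.image c, ∀ g ∈ A,
    g • x₀ ∈ halfspace ((a * x) • x₀) ((a * x * f ^ D) • x₀) with hGood
  refine ⟨A.filter Good, Finset.filter_subset _ _, ?_, fun a ha => (Finset.mem_filter.1 ha).2⟩
  set U := A.filter fun a => ¬ Good a with hU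
  have hcard : (A.filter Good).card + U.card = A.card := Finset.card_filter_add_card_filter_not _
  have h1 : 2 ^ k * U.card ≤ N * A.card := by
    refine (two_pow_mul_card_le_card_mul_pow hP U k).trans (hN A _ ?_)
    intro u hu i
    obtain ⟨a, ha, p, hp, rfl⟩ := Finset.mem_mul.1 hu
    have hbad := (Finset.mem_filter.1 ha).2
    simp only [hGood, not_exists, not_and, not_forall] at hbad
    obtain ⟨g, hg, hg'⟩ := hbad (p * c i)
      (Finset.mul_mem_mul hp (Finset.mem_image_of_mem c (Finset.mem_univ i)))
    refine ⟨g, hg, hD₀ D hD _ _ ?_⟩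
    rw [← mul_assoc] at hg'
    exact (not_le.1 hg').le
  have h2 : (2 : ℝ) ^ k * U.card ≤ N * A.card := by exact_mod_cast h1
  have h3 : (N : ℝ) * A.card ≤ 2 ^ k * ε * A.card := by gcongr
  have h4 : (U.card : ℝ) ≤ ε * A.card := by
    have h5 : (2 : ℝ) ^ k * U.card ≤ 2 ^ k * (ε * A.card) := by linarith
    exact le_of_mul_le_mul_left h5 (by positivity)
  have h5 : ((A.filter Good).card : ℝ) + U.card = A.card := by exact_mod_cast hcard
  linarith

/-- The points closer to `b x₀` than to `b f ^ D x₀` are the translate by `b f ^ D` of the points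
closer to `f⁻¹ ^ D x₀` than to `x₀`, to which `exists_disjoint_halfspaces` applies with `f⁻¹`. -/
theorem exists_disjoint_halfspace_smul (hX : FourPoint Δ X) (hK : OrbitDefect f x₀ K)
    (hf : IsLoxodromic x₀ f) (hwpd : IsWPD x₀ f) {w : G} (hw : w ∉ elementaryClosure f) :
    ∃ D₀ : ℕ, ∀ D : ℕ, D₀ ≤ D → ∀ b : G,
      Disjoint (halfspace (b • x₀) ((b * f ^ D) • x₀))
        ((b * f ^ D * w * (f ^ D)⁻¹ * b⁻¹) • halfspace (b • x₀) ((b * f ^ D) • x₀)) := by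
  obtain ⟨D₀, hD₀⟩ := exists_disjoint_halfspaces hX hK.inv hf.inv hwpd.inv (w := w)
    (by rwa [elementaryClosure_inv])
  refine ⟨D₀, fun D hD b => Set.disjoint_left.2 fun z hz hz' => ?_⟩
  have e1 : b * f ^ D * f⁻¹ ^ D = b := by rw [inv_pow, mul_inv_cancel_right]
  refine hD₀ D hD (b * f ^ D) z (by rw [e1]; exact hz) ?_
  rw [Set.mem_smul_set_iff_inv_smul_mem] at hz'
  have hz'' : dist ((b * f ^ D * w * (f ^ D)⁻¹ * b⁻¹)⁻¹ • z) (b • x₀) ≤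
    dist ((b * f ^ D * w * (f ^ D)⁻¹ * b⁻¹)⁻¹ • z) ((b * f ^ D) • x₀) := hz'
  rw [← dist_smul (b * f ^ D * w * (f ^ D)⁻¹ * b⁻¹) _ (b • x₀),
    ← dist_smul (b * f ^ D * w * (f ^ D)⁻¹ * b⁻¹) _ ((b * f ^ D) • x₀), smul_inv_smul,
    smul_smul, smul_smul] at hz''
  have e2 : b * f ^ D * w * (f ^ D)⁻¹ * b⁻¹ * b = b * f ^ D * w * f⁻¹ ^ D := by
    rw [inv_mul_cancel_right, inv_pow]
  have e3 : b * f ^ D * w * (f ^ D)⁻¹ * b⁻¹ * (b * f ^ D) = b * f ^ D * w := by group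
  rwa [e2, e3] at hz''

end Supporting

theorem mainTheorem5 {G X : Type*} [Group G] [MetricSpace X] [MulAction G X] [IsIsometricSMul G X]
    (δ : ℝ) (hX : IsDeltaHyperbolic δ X) (x₀ : X) (hG : ¬ IsVirtuallyCyclic G)
    (f : G) (hlox : IsLoxodromic x₀ f) (hwpd : IsWPD x₀ f)
    (S : Set G) (hSfin : S.Finite) (hSgen : Subgroup.closure S = ⊤) :
    (∃ w ∈ S, w ∉ elementaryClosure f) ∧
    (∀ w : G, w ∉ elementaryClosure f →
      ∃ D₀ : ℕ, ∀ ε : ℝ, 0 < ε → ∀ D : ℕ, D₀ < D → ∃ N : ℕ, ∀ A : Finset G,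
        ∃ A' : Finset G, A' ⊆ A ∧ (1 - ε) * (A.card : ℝ) ≤ (A'.card : ℝ) ∧
          ∀ a ∈ A', ∃ b : G, wordDist S a b ≤ N ∧
            (fun g : G => g • x₀) '' (A : Set G) ⊆ halfspace (b • x₀) ((b * f ^ D) • x₀) ∧
            Disjoint (halfspace (b • x₀) ((b * f ^ D) • x₀))
              ((b * f ^ D * w * (f ^ D)⁻¹ * b⁻¹) •
                halfspace (b • x₀) ((b * f ^ D) • x₀))) ∧
    (∃ D₀ : ℕ, ∀ D : ℕ, D₀ < D →
      SupportingHalfspaceCondition S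
        (fun g : G => {u : G | u • x₀ ∈ halfspace (g • x₀) ((g * f ^ D) • x₀)})) := by
  classical
  have hδ : 0 < 6 * δ := by linarith [hX.1]
  have hfour := hX.fourPoint
  obtain ⟨K, hK⟩ := hlox.exists_orbitDefect hfour hδ
  have hFG : Group.FG G := Group.fg_iff.2 ⟨S, hSgen, hSfin⟩
  obtain ⟨c, hc⟩ := exists_three_cosets hfour hδ.le hK hlox hwpd hG
  have hwS : ∃ w ∈ S, w ∉ elementaryClosure f := by
    by_contra! hcon
    have htop : elementarySubgroup f = ⊤ := by
      rw [eq_top_iff, ← hSgen, Subgroup.closure_le]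
      exact hcon
    exact hc 0 1 (by decide) (mem_elementarySubgroup.1 (htop ▸ Subgroup.mem_top _))
  obtain ⟨D₁, hD₁⟩ := exists_supporting_halfspaces hfour hδ.le hK hlox hwpd hc
  refine ⟨hwS, ?_, ?_⟩
  · intro w hw
    obtain ⟨D₂, hD₂⟩ := exists_disjoint_halfspace_smul hfour hK hlox hwpd hw
    refine ⟨max D₁ D₂, fun ε hε D hD => ?_⟩
    obtain ⟨Q, hQ⟩ := hD₁ ε hε
    obtain ⟨N, hN⟩ := exists_forall_wordNorm_le S Q
    refine ⟨N, fun A => ?_⟩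
    obtain ⟨A', hA', hcard, hx⟩ := hQ D ((le_max_left _ _).trans hD.le) A
    refine ⟨A', hA', hcard, fun a ha => ?_⟩
    obtain ⟨x, hxQ, hx⟩ := hx a ha
    refine ⟨a * x, (wordDist_mul_right S a x).trans_le (hN x hxQ), ?_,
      hD₂ D ((le_max_right _ _).trans hD.le) _⟩
    rintro _ ⟨g, hg, rfl⟩
    exact hx g hg
  · obtain ⟨w, -, hw⟩ := hwS
    obtain ⟨D₂, hD₂⟩ := exists_disjoint_halfspace_smul hfour hK hlox hwpd hw
    refine ⟨max D₁ D₂, fun D hD => ?_⟩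
    obtain ⟨Q, hQ⟩ := hD₁ (1 / 2) (by norm_num)
    set h : G → G := fun g => g * f ^ D * w * (f ^ D)⁻¹ * g⁻¹ with hh
    obtain ⟨N, hN⟩ := exists_forall_wordNorm_le S (Q ∪ Q.image h)
    refine ⟨N + 1, by positivity, fun A => ?_⟩
    obtain ⟨A', hA', hcard, hx⟩ := hQ D ((le_max_left _ _).trans hD.le) A
    refine ⟨A', hA', by linarith, fun a ha => ?_⟩
    obtain ⟨x, hxQ, hx⟩ := hx a ha
    have hNx : (wordNorm S x : ℝ) ≤ N := by
      exact_mod_cast hN x (Finset.mem_union_left _ hxQ)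
    have hNh : (wordNorm S (h x) : ℝ) ≤ N := by
      exact_mod_cast hN (h x) (Finset.mem_union_right _ (Finset.mem_image_of_mem h hxQ))
    refine ⟨x, h x, by linarith, by linarith, ?_, ?_⟩
    · intro g hg
      rw [Set.mem_smul_set_iff_inv_smul_mem]
      have := hx g hg
      change dist _ _ ≤ dist _ _ at this
      change dist _ _ ≤ dist _ _
      rw [← dist_smul a _ (x • x₀), ← dist_smul a _ ((x * f ^ D) • x₀)]
      simpa only [smul_eq_mul, smul_smul, mul_inv_cancel_left, mul_assoc] using this
    · rw [← Set.disjoint_iff_inter_eq_empty]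
      refine Set.disjoint_left.2 fun g hg hg' => ?_
      refine Set.disjoint_left.1 (hD₂ D ((le_max_right _ _).trans hD.le) x) hg ?_
      rw [Set.mem_smul_set_iff_inv_smul_mem] at hg' ⊢
      have hg'' : ((h x)⁻¹ * g) • x₀ ∈ halfspace (x • x₀) ((x * f ^ D) • x₀) := hg'
      rw [mul_smul (h x)⁻¹] at hg''
      exact hg''
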